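/- Let $p$ be a prime, let $K$ be a non-archimedean local field (for instance $\mathbf{Q}_p$ or $\mathbf{F}_p((T))$), and let $\mathbf{C}$ be the completion of an algebraic closure of $K$. Let $S$ be a finite set, and for each $\mathfrak p\in S$ let $F_{\mathfrak p}$ be a non-archimedean local field of residue characteristic $p$ together with a continuous embedding $\iota_{\mathfrak p}\colon F_{\mathfrak p}\hookrightarrow\mathbf{C}$ (so all $F_{\mathfrak p}$ have the same characteristic as $K$). For $S'\subseteq S$ put $\mathbb{P}(\mathbf{C}_{S'})=\prod_{\mathfrak p\in S'}\mathbb{P}^1(\mathbf{C})$, with the product topology; the group $\mathrm{PGL}_2(F_S)=\prod_{\mathfrak p\in S}\mathrm{PGL}_2(F_{\mathfrak p})$ acts on $\mathbb{P}(\mathbf{C}_S)$ through the $\iota_{\mathfrak p}$. For a subgroup $\Gamma\subseteq \mathrm{PGL}_2(F_S)$ let $\mathcal L_\Gamma^S$ be its set of limit points, i.e. the set of $x\in\mathbb{P}(\mathbf{C}_S)$ for which there are $y\in\mathbb{P}(\mathbf{C}_S)$ and pairwise distinct $\gamma_1,\gamma_2,\ldots\in\Gamma$ with $\gamma_j(y)\to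 x$. The subgroup $\Gamma$ is called plectic if there are subsets $\mathcal L_{\Gamma,\mathfrak p}\subseteq\mathbb{P}^1(F_{\mathfrak p})$, $\mathfrak p\in S$, such that $$\mathcal L_\Gamma^S=\bigcup_{\mathfrak p\in S}\Big(\mathcal L_{\Gamma,\mathfrak p}\times\mathbb{P}(\mathbf{C}_{S\setminus\{\mathfrak p\}})\Big),$$ where $\mathbb{P}^1(F_{\mathfrak p})$ is viewed inside $\mathbb{P}^1(\mathbf{C})$ via $\iota_{\mathfrak p}$. Let $\Gamma\subseteq \mathrm{PGL}_2(F_S)$ be a plectic subgroup, with sets $\mathcal L_{\Gamma,\mathfrak p}$ as above. Then for every $\mathfrak p\in S$ one of the following holds: (i) $\mathcal L_{\Gamma,\mathfrak p}=\emptyset$; (ii) $|\mathcal L_{\Gamma,\mathfrak p}|=1$ and $\mathrm{char}(F_{\mathfrak p})=p$; (iii) $|\mathcal L_{\Gamma,\mathfrak p}|=2$; (iv) $\mathcal L_{\Gamma,\mathfrak p}$ is a perfect subset of $\mathbb{P}^1(F_{\mathfrak p})$, i.e. closed and without isolated points. -/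

import Mathlib

open Filter Topology
open scoped MatrixGroups LinearAlgebra.Projectivization ValuativeRel

/-- The quotient topology on a projective space over a topological vector space. -/
instance Projectivization.instQuotientTopology (K V : Type*) [DivisionRing K] [AddCommGroup V]
    [Module K V] [TopologicalSpace V] : TopologicalSpace (ℙ K V) :=
  TopologicalSpace.coinduced (Projectivization.mk' K) inferInstance

namespace Plectic

noncomputable section

/-- An algebraic closure of the complete non-archimedean field `K`; it carries the unique
extension of the absolute value of `K`. -/
def AlgCl (K : Type*) [Field K] : Type _ := AlgebraicClosure K

instance (K : Type*) [Field K] : Field (AlgCl K) := inferInstanceAs (Field (AlgebraicClosure K))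

instance (K : Type*) [Field K] : Algebra K (AlgCl K) :=
  inferInstanceAs (Algebra K (AlgebraicClosure K))

instance (K : Type*) [Field K] : IsAlgClosure K (AlgCl K) :=
  inferInstanceAs (IsAlgClosure K (AlgebraicClosure K))

instance (K : Type*) [Field K] : Algebra.IsAlgebraic K (AlgCl K) :=
  inferInstanceAs (Algebra.IsAlgebraic K (AlgebraicClosure K))

instance (K : Type*) [NontriviallyNormedField K] [IsUltrametricDist K] [CompleteSpace K] :
    NormedField (AlgCl K) :=
  spectralNorm.normedField K (AlgCl K)

instance (K : Type*) [NontriviallyNormedField K] [IsUltrametricDist K] [CompleteSpace K] :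
    NormedAlgebra K (AlgCl K) :=
  spectralNorm.normedAlgebra K (AlgCl K)

/-- The completion `𝐂` of an algebraic closure of `K`. For `K = ℚ_p` this is `ℂ_p`. -/
abbrev CompletedAlgCl (K : Type*) [NontriviallyNormedField K] [IsUltrametricDist K]
    [CompleteSpace K] : Type _ :=
  UniformSpace.Completion (AlgCl K)

/-- The projective line `ℙ¹(K)` over a field `K`, the set of lines in `K²`. -/
abbrev ProjLine (K : Type*) [Field K] : Type _ := ℙ K (Fin 2 → K)

/-- The entrywise map `F² → E²` induced by a ring homomorphism `F → E`. -/
def entrywise {F E : Type*} [Field F] [Field E] (f : F →+* E) :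
    (Fin 2 → F) →ₛₗ[f] (Fin 2 → E) where
  toFun v k := f (v k)
  map_add' v w := by ext k; simp
  map_smul' a v := by ext k; simp

lemma entrywise_injective {F E : Type*} [Field F] [Field E] (f : F →+* E) :
    Function.Injective (entrywise f) :=
  fun _ _ h => funext fun k => f.injective (congrFun h k)

/-- The inclusion `ℙ¹(F) → ℙ¹(E)` induced by a field embedding `F → E`. -/
def ProjLine.incl {F E : Type*} [Field F] [Field E] (f : F →+* E) : ProjLine F → ProjLine E :=
  Projectivization.map (entrywise f) (entrywise_injective f)

section LimitPoints

variable {S : Type*} {F : S → Type*} [∀ 𝔭, Field (F 𝔭)] {C : Type*} [Field C]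

/-- The action of `PGL₂(F_S) = ∏ PGL₂(F_𝔭)` on `ℙ¹(𝐂_S) = ∏ ℙ¹(𝐂)` through the embeddings
`ι_𝔭 : F_𝔭 → 𝐂`. -/
def act (ι : ∀ 𝔭, F 𝔭 →+* C) (g : ∀ 𝔭, PGL(2, F 𝔭)) (x : S → ProjLine C) : S → ProjLine C :=
  fun 𝔭 => Matrix.ProjGenLinGroup.map (ι 𝔭) (g 𝔭) • x 𝔭

variable [TopologicalSpace C]

/-- The set of limit points of `Γ ⊆ PGL₂(F_S)` in `ℙ¹(𝐂_S)`: the limits of sequences `γ_j(y)`,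
where `y` is a point and the `γ_j` are pairwise distinct elements of `Γ`. -/
def limitSet (ι : ∀ 𝔭, F 𝔭 →+* C) (Γ : Subgroup (∀ 𝔭, PGL(2, F 𝔭))) : Set (S → ProjLine C) :=
  {x | ∃ (y : S → ProjLine C) (γ : ℕ → ∀ 𝔭, PGL(2, F 𝔭)),
    Function.Injective γ ∧ (∀ j, γ j ∈ Γ) ∧ Tendsto (fun j => act ι (γ j) y) atTop (𝓝 x)}

/-- `Γ` is plectic, with the sets `L 𝔭 ⊆ ℙ¹(F_𝔭)` in the role of `𝓛_{Γ,𝔭}`: the limit set of `Γ`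
is the union over `𝔭 ∈ S` of the sets `L 𝔭 × ℙ¹(𝐂_{S ∖ {𝔭}})`. -/
def IsPlecticWith (ι : ∀ 𝔭, F 𝔭 →+* C) (Γ : Subgroup (∀ 𝔭, PGL(2, F 𝔭)))
    (L : ∀ 𝔭, Set (ProjLine (F 𝔭))) : Prop :=
  limitSet ι Γ = ⋃ 𝔭, {x | x 𝔭 ∈ ProjLine.incl (ι 𝔭) '' L 𝔭}

end LimitPoints

end

end Plectic

namespace Plectic

/-! Scaled lifts of elements of `PGL₂(F_q)` lie in a compact set of nonzero matrices, so every
sequence in `Γ` has a subsequence converging, at each `q`, to a nonzero matrix `A q`. If `A q` is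
invertible, the sequence converges on `ℙ¹(𝐂)` to a projective transformation over `F_q`. If `A q = u
wᵀ` has rank one, every point except the kernel `rot w` is moved to the attracting point `u`. No `ι
q` is surjective, because nonzero elements of `F_q` with roots of all orders are units while `𝐂` is
algebraically closed. Hence there are points of `ℙ¹(𝐂)` off `ℙ¹(F_q)`, and on these the limit lies
in `ℙ¹(F_q)` exactly when `det (A q) = 0`.

Let `G = integralAway Γ 𝔭`. Testing the plectic condition on such points shows that `G` is discrete
(`IsPlecticWith.not_injective`) and that `L 𝔭` is the set of attracting points of rank-one limits of
`G` (`IsPlecticWith.subset_attractors`, `IsPlecticWith.attractors_subset`). This reduces the theorem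
to one discrete group acting on one projective line.

The set of attractors is closed and `G`-stable, and contains `rot w` along with `u`, since inversion
is the adjugate up to scalars. With at least three attractors, two of them avoid `rot w` and are
moved towards `u` while staying distinct, so `u` is not isolated (`perfect_attractors`). A single
attractor is fixed by `G`, which is then upper triangular in a suitable basis, with a nilpotent
limit matrix. In characteristic zero discreteness rules out nontrivial translations, which makes the
group commutative, then scalar, contradicting that limit (`attractors_ne_singleton`). In
characteristic `p` a translation has finite order and this argument stops. -/

lemma tendsto_mk {K : Type*} [Field K] [TopologicalSpace K] {α : Type*} {l : Filter α} {v : α → Fin 2 → K} {w : Fin 2 → K}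
    (hv : ∀ j, v j ≠ 0) (hw : w ≠ 0) (h : Tendsto v l (𝓝 w)) :
    Tendsto (fun j => Projectivization.mk K (v j) (hv j)) l (𝓝 (Projectivization.mk K w hw)) := by
  have hc : Continuous (Projectivization.mk' K : {v : Fin 2 → K // v ≠ 0} → ProjLine K) :=
    continuous_coinduced_rng
  have : Tendsto (fun j => (⟨v j, hv j⟩ : {v : Fin 2 → K // v ≠ 0})) l (𝓝 ⟨w, hw⟩) :=
    tendsto_subtype_rng.2 h
  exact (hc.tendsto _).comp this

/-- Two nonzero vectors in `K²` span the same line if and only if their determinant vanishes. -/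
lemma mk_eq_mk_iff_det {K : Type*} [Field K] {v w : Fin 2 → K} (hv : v ≠ 0) (hw : w ≠ 0) :
    Projectivization.mk K v hv = Projectivization.mk K w hw ↔ v 0 * w 1 = v 1 * w 0 := by
  rw [Projectivization.mk_eq_mk_iff']
  constructor
  · rintro ⟨a, rfl⟩
    simp only [Pi.smul_apply, smul_eq_mul]
    ring
  · intro h
    by_cases h0 : w 0 = 0
    · have h1 : w 1 ≠ 0 := fun h1 => hw (by ext k; fin_cases k <;> simp [h0, h1])
      have hv0 : v 0 = 0 := by simpa [h0, h1] using h
      refine ⟨v 1 / w 1, ?_⟩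
      ext k; fin_cases k <;> simp [h0, h1, hv0]
    · refine ⟨v 0 / w 0, ?_⟩
      ext k; fin_cases k
      · simp [h0]
      · simp only [Fin.mk_one, Pi.smul_apply, smul_eq_mul]
        field_simp
        rw [mul_comm (w 0), h]

/-! ### Topology of the projective line -/

section ProjLineTopology

variable {K : Type*} [Field K] [TopologicalSpace K] [IsTopologicalRing K]

/-- The saturation of an open set is the union of its translates under the scaling homeomorphisms.
Openness reduces the Hausdorff property to closedness of the relation, which is the vanishing of a
determinant. -/
lemma isOpenQuotientMap_mk' :
    IsOpenQuotientMap (Projectivization.mk' K : {v : Fin 2 → K // v ≠ 0} → ProjLine K) := by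
  refine ⟨Quotient.mk''_surjective, continuous_coinduced_rng, fun U hU => ?_⟩
  rw [isOpen_coinduced]
  have hsm : ∀ u : Kˣ, Continuous fun v : {v : Fin 2 → K // v ≠ 0} =>
      (⟨u • v.1, (smul_ne_zero_iff_ne u).2 v.2⟩ : {v : Fin 2 → K // v ≠ 0}) := fun u =>
    Continuous.subtype_mk (by
      have : Continuous fun v : {v : Fin 2 → K // v ≠ 0} => (u : K) • v.1 :=
        continuous_pi fun k => continuous_const.mul ((continuous_apply k).comp
          continuous_subtype_val)
      exact this) _
  have : Projectivization.mk' K ⁻¹' (Projectivization.mk' K '' U) =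
      ⋃ u : Kˣ, (fun v : {v : Fin 2 → K // v ≠ 0} =>
      (⟨u • v.1, (smul_ne_zero_iff_ne u).2 v.2⟩ : {v : Fin 2 → K // v ≠ 0})) ⁻¹' U := by
    ext ⟨v, hv⟩
    simp only [Set.mem_preimage, Set.mem_image, Set.mem_iUnion]
    constructor
    · rintro ⟨⟨w, hw⟩, hwU, h⟩
      obtain ⟨u, hu⟩ := (Projectivization.mk_eq_mk_iff K w v hw hv).1 h
      refine ⟨u, ?_⟩
      convert hwU
    · rintro ⟨u, hu⟩
      exact ⟨_, hu, (Projectivization.mk_eq_mk_iff K _ v _ hv).2 ⟨u, rfl⟩⟩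
  rw [this]
  exact isOpen_iUnion fun u => hU.preimage (hsm u)

instance [T2Space K] : T2Space (ProjLine K) := by
  rw [t2Space_iff_of_isOpenQuotientMap isOpenQuotientMap_mk']
  have : {q : {v : Fin 2 → K // v ≠ 0} × {v : Fin 2 → K // v ≠ 0} |
      Projectivization.mk' K q.1 = Projectivization.mk' K q.2} =
      {q | q.1.1 0 * q.2.1 1 = q.1.1 1 * q.2.1 0} := by
    ext ⟨⟨v, hv⟩, ⟨w, hw⟩⟩
    exact mk_eq_mk_iff_det hv hw
  rw [this]
  have h1 : ∀ k, Continuous fun q : {v : Fin 2 → K // v ≠ 0} × {v : Fin 2 → K // v ≠ 0} =>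
      q.1.1 k := fun k => (continuous_apply k).comp (continuous_subtype_val.comp continuous_fst)
  have h2 : ∀ k, Continuous fun q : {v : Fin 2 → K // v ≠ 0} × {v : Fin 2 → K // v ≠ 0} =>
      q.2.1 k := fun k => (continuous_apply k).comp (continuous_subtype_val.comp continuous_snd)
  exact isClosed_eq ((h1 0).mul (h2 1)) ((h1 1).mul (h2 0))

end ProjLineTopology

section Incl

variable {F C : Type*} [Field F] [Field C] (f : F →+* C)

lemma comp_ne_zero {v : Fin 2 → F} (hv : v ≠ 0) : f ∘ v ≠ 0 := fun h =>
  hv (entrywise_injective f (h.trans (map_zero (entrywise f)).symm))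

lemma incl_mk {v : Fin 2 → F} (hv : v ≠ 0) :
    ProjLine.incl f (Projectivization.mk F v hv) =
      Projectivization.mk C (f ∘ v) (comp_ne_zero f hv) := rfl

lemma incl_injective : Function.Injective (ProjLine.incl f) := by
  intro x y
  induction x using Projectivization.ind with | _ v hv =>
  induction y using Projectivization.ind with | _ w hw =>
  rw [incl_mk, incl_mk, mk_eq_mk_iff_det, mk_eq_mk_iff_det]
  intro h
  apply f.injective
  simpa using h

lemma continuous_incl [TopologicalSpace F] [TopologicalSpace C] (hf : Continuous f) :
    Continuous (ProjLine.incl f) := by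
  refine continuous_coinduced_dom.2 ?_
  have hc : Continuous (Projectivization.mk' C : {v : Fin 2 → C // v ≠ 0} → ProjLine C) :=
    continuous_coinduced_rng
  exact hc.comp (f := fun v : {v : Fin 2 → F // v ≠ 0} => (⟨f ∘ v.1, comp_ne_zero f v.2⟩ :
    {v : Fin 2 → C // v ≠ 0})) (Continuous.subtype_mk (continuous_pi fun k =>
      hf.comp ((continuous_apply k).comp continuous_subtype_val)) _)

end Incl

/-! ### Normalized representatives, and compactness over a local field -/

section Normalized

open ValuativeRel

/-- The vectors of `F²` with integral entries, one of which is `1`. -/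
def normalizedVectors (F : Type*) [Field F] [ValuativeRel F] : Set (Fin 2 → F) :=
  {v | (∀ k, valuation F (v k) ≤ 1) ∧ ∃ k, v k = 1}

/-- The `2 × 2` matrices with integral entries, one of which is `1`. -/
def normalizedMatrices (F : Type*) [Field F] [ValuativeRel F] : Set (Matrix (Fin 2) (Fin 2) F) :=
  {A | (∀ i k, valuation F (A i k) ≤ 1) ∧ ∃ i k, A i k = 1}

variable {F : Type*} [Field F] [ValuativeRel F]

lemma ne_zero_of_mem_normalizedVectors {v : Fin 2 → F} (hv : v ∈ normalizedVectors F) :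
    v ≠ 0 := by
  rintro rfl
  obtain ⟨k, hk⟩ := hv.2
  simp at hk

lemma ne_zero_of_mem_normalizedMatrices {A : Matrix (Fin 2) (Fin 2) F}
    (hA : A ∈ normalizedMatrices F) : A ≠ 0 := by
  rintro rfl
  obtain ⟨i, k, hk⟩ := hA.2
  simp at hk

lemma exists_smul_mem_normalizedVectors {v : Fin 2 → F} (hv : v ≠ 0) :
    ∃ c : Fˣ, c • v ∈ normalizedVectors F := by
  obtain ⟨k, hk⟩ := Finite.exists_max fun k => valuation F (v k)
  have h0 : v k ≠ 0 := by
    intro h0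
    apply hv
    ext l
    simpa [h0] using hk l
  refine ⟨(Units.mk0 _ h0)⁻¹, fun l => ?_, k, ?_⟩
  · simp only [Pi.smul_apply, Units.smul_def, Units.val_inv_eq_inv_val, Units.val_mk0, smul_eq_mul,
      map_mul, map_inv₀]
    rw [inv_mul_le_iff₀ (by simpa [zero_lt_iff] using h0), mul_one]
    exact hk l
  · simp [Units.smul_def, h0]

lemma exists_smul_mem_normalizedMatrices {A : Matrix (Fin 2) (Fin 2) F} (hA : A ≠ 0) :
    ∃ c : Fˣ, (c : F) • A ∈ normalizedMatrices F := by
  obtain ⟨k, hk⟩ := Finite.exists_max fun k : Fin 2 × Fin 2 => valuation F (A k.1 k.2)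
  have h0 : A k.1 k.2 ≠ 0 := by
    intro h0
    apply hA
    ext i l
    simpa [h0] using hk (i, l)
  refine ⟨(Units.mk0 _ h0)⁻¹, fun i l => ?_, k.1, k.2, ?_⟩
  · simp only [Matrix.smul_apply, Units.val_inv_eq_inv_val, Units.val_mk0, smul_eq_mul,
      map_mul, map_inv₀]
    rw [inv_mul_le_iff₀ (by simpa [zero_lt_iff] using h0), mul_one]
    exact hk (i, l)
  · simp [h0]

lemma exists_mem_normalizedVectors (x : ProjLine F) :
    ∃ v, ∃ hv : v ∈ normalizedVectors F,
      Projectivization.mk F v (ne_zero_of_mem_normalizedVectors hv) = x := by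
  induction x using Projectivization.ind with | _ v hv =>
  obtain ⟨c, hc⟩ := exists_smul_mem_normalizedVectors hv
  exact ⟨_, hc, (Projectivization.mk_eq_mk_iff F _ _ _ _).2 ⟨c, rfl⟩⟩

end Normalized

section LocalField

open ValuativeRel

variable {F : Type*} [Field F] [ValuativeRel F] [TopologicalSpace F]
  [IsNonarchimedeanLocalField F]

instance (priority := low) instT2SpaceLocalField : T2Space F := by
  let := IsTopologicalAddGroup.rightUniformSpace F
  have := isUniformAddGroup_of_addCommGroup (G := F)
  infer_instance

instance : Countable (ValueGroupWithZero F) := by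
  have : Countable (WithZero (Multiplicative ℤ)) := inferInstanceAs (Countable (Option ℤ))
  exact (IsNonarchimedeanLocalField.valueGroupWithZeroIsoInt F).toEquiv.countable_iff.2 this

instance (priority := low) instFirstCountableLocalField : FirstCountableTopology F where
  nhds_generated_countable x := by
    have : (𝓝 (0 : F)).IsCountablyGenerated :=
      (IsValuativeTopology.hasBasis_nhds_zero' F).isCountablyGenerated
    rw [← map_add_left_nhds_zero x]
    infer_instance

lemma isCompact_normalizedVectors : IsCompact (normalizedVectors F) := by
  have h : normalizedVectors F = (Set.univ.pi fun _ => {x | valuation F x ≤ 1}) ∩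
      ⋃ k, {v : Fin 2 → F | v k = 1} := by
    ext v; simp [normalizedVectors]
  rw [h]
  exact (isCompact_univ_pi fun _ => IsNonarchimedeanLocalField.isCompact_closedBall F 1).inter_right
    (isClosed_iUnion_of_finite fun k => isClosed_eq (continuous_apply k) continuous_const)

lemma isCompact_normalizedMatrices : IsCompact (normalizedMatrices F) := by
  have h : normalizedMatrices F =
      (Set.univ.pi fun _ => Set.univ.pi fun _ => {x | valuation F x ≤ 1}) ∩
      ⋃ i, ⋃ k, {A : Matrix (Fin 2) (Fin 2) F | A i k = 1} := by
    ext A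
    refine and_congr ⟨fun h i _ k _ => h i k, fun h i k => h i trivial k trivial⟩ ⟨?_, ?_⟩
    · exact fun ⟨i, k, h⟩ => Set.mem_iUnion.2 ⟨i, Set.mem_iUnion.2 ⟨k, h⟩⟩
    · intro h
      obtain ⟨i, hi⟩ := Set.mem_iUnion.1 h
      obtain ⟨k, hk⟩ := Set.mem_iUnion.1 hi
      exact ⟨i, k, hk⟩
  rw [h]
  exact (isCompact_univ_pi fun _ => isCompact_univ_pi fun _ =>
    IsNonarchimedeanLocalField.isCompact_closedBall F 1).inter_right
    (isClosed_iUnion_of_finite fun i => isClosed_iUnion_of_finite fun k =>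
      isClosed_eq (continuous_id.matrix_elem i k) continuous_const)

instance : CompactSpace (ProjLine F) := by
  have : CompactSpace (normalizedVectors F) :=
    isCompact_iff_compactSpace.1 isCompact_normalizedVectors
  let f : normalizedVectors F → ProjLine F := fun v =>
    Projectivization.mk' F ⟨v.1, ne_zero_of_mem_normalizedVectors v.2⟩
  have hf : Continuous f := by
    have hc : Continuous (Projectivization.mk' F : {v : Fin 2 → F // v ≠ 0} → ProjLine F) :=
      continuous_coinduced_rng
    exact hc.comp (continuous_subtype_val.subtype_mk _)
  refine Function.Surjective.compactSpace (f := f) hf (fun x => ?_)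
  obtain ⟨v, hv, h⟩ := exists_mem_normalizedVectors x
  exact ⟨⟨v, hv⟩, h⟩

lemma isClosedEmbedding_incl {C : Type*} [Field C] [TopologicalSpace C] [IsTopologicalRing C]
    [T2Space C] {f : F →+* C} (hf : Continuous f) : IsClosedEmbedding (ProjLine.incl f) :=
  (continuous_incl f hf).isClosedEmbedding (incl_injective f)

end LocalField

open scoped Matrix

/-! ### Rank-one matrices and points off `ℙ¹(F)` -/

section Algebra

lemma coe_mul_scalar {R : Type*} [CommRing R] (N : GL (Fin 2) R) (c : Rˣ) :
    (N * .scalar (Fin 2) c).1 = (c : R) • N.1 := by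
  rw [Units.val_mul, Matrix.GeneralLinearGroup.coe_scalar, Matrix.scalar_apply,
    ← Matrix.smul_one_eq_diagonal, Matrix.mul_smul, mul_one]

variable {F C : Type*} [Field F] [Field C] (f : F →+* C)

/-- The vector `w` rotated by a quarter turn; it spans the kernel of the linear form `w ⬝ᵥ ·`. -/
def rot (w : Fin 2 → F) : Fin 2 → F := ![-w 1, w 0]

lemma rot_ne_zero {w : Fin 2 → F} (hw : w ≠ 0) : rot w ≠ 0 := by
  intro h
  apply hw
  ext k
  fin_cases k
  · simpa [rot] using congrFun h 1
  · simpa [rot] using congrFun h 0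

lemma vecMulVec_ne_zero' {u w : Fin 2 → F} (hu : u ≠ 0) (hw : w ≠ 0) :
    Matrix.vecMulVec u w ≠ 0 := by
  obtain ⟨i, hi⟩ := Function.ne_iff.1 hu
  obtain ⟨k, hk⟩ := Function.ne_iff.1 hw
  intro h
  have := congrFun (congrFun h i) k
  simp only [Matrix.vecMulVec_apply, Matrix.zero_apply, mul_eq_zero] at this
  exact this.elim hi hk

lemma det_vecMulVec_two (u w : Fin 2 → F) : (Matrix.vecMulVec u w).det = 0 := by
  rw [Matrix.det_fin_two]
  simp only [Matrix.vecMulVec_apply]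
  ring

/-- The adjugate represents the inverse in `PGL₂`, so passing to inverses exchanges the attracting
point `u` with the repelling point `rot w`. -/
lemma adjugate_vecMulVec (u w : Fin 2 → F) :
    (Matrix.vecMulVec u w).adjugate = Matrix.vecMulVec (rot w) (rot u) := by
  rw [Matrix.adjugate_fin_two]
  ext i k
  fin_cases i <;> fin_cases k <;> simp [Matrix.vecMulVec_apply, rot] <;> ring

lemma exists_eq_vecMulVec {A : Matrix (Fin 2) (Fin 2) F} (hA : A ≠ 0) (hdet : A.det = 0) :
    ∃ u w : Fin 2 → F, u ≠ 0 ∧ w ≠ 0 ∧ A = Matrix.vecMulVec u w := by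
  obtain ⟨i, k, hik⟩ : ∃ i k, A i k ≠ 0 := by
    by_contra! h
    exact hA (by ext i k; exact h i k)
  have key : ∀ l m, A l m * A i k = A l k * A i m := by
    rw [Matrix.det_fin_two] at hdet
    intro l m
    fin_cases i <;> fin_cases k <;> fin_cases l <;> fin_cases m <;>
      simp only [Fin.zero_eta, Fin.mk_one, Fin.isValue] <;>
      first | linear_combination (0 : F) * hdet | linear_combination hdet | linear_combination -hdet
  refine ⟨fun l => A l k / A i k, A i, fun h => ?_, fun h => ?_, ?_⟩
  · simpa [hik] using congrFun h i
  · exact hik (congrFun h k)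
  · ext l m
    rw [Matrix.vecMulVec_apply, div_mul_eq_mul_div, eq_div_iff hik]
    exact key l m

lemma map_vecMulVec_mulVec (u w : Fin 2 → F) (v : Fin 2 → C) :
    (Matrix.vecMulVec u w).map f *ᵥ v = ((f ∘ w) ⬝ᵥ v) • (f ∘ u) := by
  ext i
  simp [Matrix.mulVec, dotProduct, Matrix.vecMulVec_apply]
  ring

lemma mk_eq_incl_rot {w : Fin 2 → F} (hw : w ≠ 0) {v : Fin 2 → C} (hv : v ≠ 0) :
    Projectivization.mk C v hv = ProjLine.incl f (Projectivization.mk F (rot w) (rot_ne_zero hw)) ↔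
      (f ∘ w) ⬝ᵥ v = 0 := by
  rw [incl_mk, mk_eq_mk_iff_det]
  simp only [rot, Function.comp_apply, dotProduct, Fin.sum_univ_two, Matrix.cons_val_zero,
    Matrix.cons_val_one, map_neg]
  constructor <;> intro h <;> linear_combination h

lemma map_smul_mk (M : GL (Fin 2) F) {v : Fin 2 → C} (hv : v ≠ 0) (h : M.1.map f *ᵥ v ≠ 0) :
    Matrix.ProjGenLinGroup.map f (.mk M) • Projectivization.mk C v hv =
      Projectivization.mk C (M.1.map f *ᵥ v) h := rfl

lemma map_mulVec_ne_zero {A : Matrix (Fin 2) (Fin 2) F} (hA : A.det ≠ 0) {v : Fin 2 → C}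
    (hv : v ≠ 0) : A.map f *ᵥ v ≠ 0 := by
  intro h
  refine hv (Matrix.eq_zero_of_mulVec_eq_zero ?_ h)
  rw [← RingHom.mapMatrix_apply, ← RingHom.map_det]
  simpa using hA

lemma map_smul_incl (g : PGL(2, F)) (x : ProjLine F) :
    Matrix.ProjGenLinGroup.map f g • ProjLine.incl f x = ProjLine.incl f (g • x) := by
  induction g using Matrix.ProjGenLinGroup.induction_on with | mk M =>
  induction x using Projectivization.ind with | _ v hv =>
  rw [incl_mk, map_smul_mk f M _ (map_mulVec_ne_zero f M.det_ne_zero (comp_ne_zero f hv)),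
    Projectivization.PGL.mk_smul_mk, incl_mk]
  congr 1
  ext i
  change _ = f ((M.1 *ᵥ v) i)
  simp [Matrix.mulVec, dotProduct]

lemma map_smul_notMem_range_incl (g : PGL(2, F)) {y : ProjLine C}
    (hy : y ∉ Set.range (ProjLine.incl f)) :
    Matrix.ProjGenLinGroup.map f g • y ∉ Set.range (ProjLine.incl f) := by
  rintro ⟨x, hx⟩
  refine hy ⟨g⁻¹ • x, ?_⟩
  rw [← map_smul_incl, hx, map_inv, inv_smul_smul]

lemma exists_notMem_range_incl (hf : ¬ Function.Surjective f) :
    ∃ y, y ∉ Set.range (ProjLine.incl f) := by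
  simp only [Function.Surjective, not_forall, not_exists] at hf
  obtain ⟨c, hc⟩ := hf
  have h : (![1, c] : Fin 2 → C) ≠ 0 := fun h => by simpa using congrFun h 0
  refine ⟨Projectivization.mk C ![1, c] h, ?_⟩
  rintro ⟨x, hx⟩
  induction x using Projectivization.ind with | _ v hv =>
  rw [incl_mk, mk_eq_mk_iff_det] at hx
  simp only [Function.comp_apply, Matrix.cons_val_zero, Matrix.cons_val_one, mul_one] at hx
  have h0 : v 0 ≠ 0 := by
    intro h0
    apply hv
    ext k
    fin_cases k
    · exact h0
    · simpa [h0] using hx.symm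
  apply hc (v 1 / v 0)
  rw [map_div₀, ← hx, mul_div_cancel_left₀ _ (by simpa using h0)]

end Algebra

/-! ### Limits of sequences in `PGL₂(F)` and their dynamics -/

section Convergence

/-- A sequence in `PGL₂(F)` converges to the class of the matrix `A` in `ℙ(M₂(F))` (if `A ≠ 0`):
suitable lifts to `GL₂(F)` converge to `A`. -/
def ConvergesTo {F : Type*} [Field F] [TopologicalSpace F] (g : ℕ → PGL(2, F))
    (A : Matrix (Fin 2) (Fin 2) F) : Prop :=
  ∃ M : ℕ → GL (Fin 2) F, (∀ j, Matrix.ProjGenLinGroup.mk (M j) = g j) ∧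
    Tendsto (fun j => (M j).1) atTop (𝓝 A)

variable {F : Type*} [Field F] [TopologicalSpace F] {g : ℕ → PGL(2, F)}
  {A : Matrix (Fin 2) (Fin 2) F}

lemma ConvergesTo.comp (h : ConvergesTo g A) {φ : ℕ → ℕ} (hφ : Tendsto φ atTop atTop) :
    ConvergesTo (fun j => g (φ j)) A := by
  obtain ⟨M, hM, h⟩ := h
  exact ⟨fun j => M (φ j), fun j => hM _, h.comp hφ⟩

lemma ConvergesTo.mul_mk [IsTopologicalRing F] (h : ConvergesTo g A) (N : GL (Fin 2) F) :
    ConvergesTo (fun j => g j * .mk N) (A * N.1) := by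
  obtain ⟨M, hM, h⟩ := h
  exact ⟨fun j => M j * N, fun j => by rw [map_mul, hM], by simpa using h.mul_const N.1⟩

lemma ConvergesTo.tendsto_smul {C : Type*} [Field C] [TopologicalSpace C] [IsTopologicalRing C]
    {f : F →+* C} (hf : Continuous f) (h : ConvergesTo g A) {v : Fin 2 → C} (hv : v ≠ 0)
    (hAv : A.map f *ᵥ v ≠ 0) :
    Tendsto (fun j => Matrix.ProjGenLinGroup.map f (g j) • Projectivization.mk C v hv) atTop
      (𝓝 (Projectivization.mk C (A.map f *ᵥ v) hAv)) := by
  obtain ⟨M, hM, h⟩ := h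
  have hc : Continuous fun B : Matrix (Fin 2) (Fin 2) F => B.map f *ᵥ v :=
    (continuous_id.matrix_map hf).matrix_mulVec continuous_const
  have := tendsto_mk (fun j => map_mulVec_ne_zero f (M j).det_ne_zero hv) hAv
    ((hc.tendsto A).comp h)
  refine this.congr fun j => ?_
  rw [← hM, map_smul_mk]

lemma ConvergesTo.tendsto_smul_of_det_ne_zero {C : Type*} [Field C] [TopologicalSpace C]
    [IsTopologicalRing C] {f : F →+* C} (hf : Continuous f) (h : ConvergesTo g A)
    (hA : A.det ≠ 0) (y : ProjLine C) :
    Tendsto (fun j => Matrix.ProjGenLinGroup.map f (g j) • y) atTop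
      (𝓝 (Matrix.ProjGenLinGroup.map f
        (.mk (Matrix.GeneralLinearGroup.mkOfDetNeZero A hA)) • y)) := by
  induction y using Projectivization.ind with | _ v hv =>
  exact h.tendsto_smul hf hv (map_mulVec_ne_zero f hA hv)

/-- The limit matrix sends `v` to `(wᵀv) u`, and `wᵀv` vanishes only on the line `rot w`. -/
lemma ConvergesTo.tendsto_smul_of_ne {C : Type*} [Field C] [TopologicalSpace C]
    [IsTopologicalRing C] {f : F →+* C} (hf : Continuous f) {u w : Fin 2 → F}
    (h : ConvergesTo g (Matrix.vecMulVec u w)) (hu : u ≠ 0) (hw : w ≠ 0) {y : ProjLine C}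
    (hy : y ≠ ProjLine.incl f (Projectivization.mk F (rot w) (rot_ne_zero hw))) :
    Tendsto (fun j => Matrix.ProjGenLinGroup.map f (g j) • y) atTop
      (𝓝 (ProjLine.incl f (Projectivization.mk F u hu))) := by
  induction y using Projectivization.ind with | _ v hv =>
  rw [ne_eq, mk_eq_incl_rot f hw] at hy
  have hne : (Matrix.vecMulVec u w).map f *ᵥ v ≠ 0 := by
    rw [map_vecMulVec_mulVec]
    exact smul_ne_zero hy (comp_ne_zero f hu)
  convert h.tendsto_smul hf hv hne using 2
  rw [incl_mk]
  refine ((Projectivization.mk_eq_mk_iff' _ _ _ _ _).2 ⟨(f ∘ w) ⬝ᵥ v, ?_⟩).symm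
  rw [map_vecMulVec_mulVec]

/-- The ratio of the square of an entry to the determinant depends only on the class in `PGL₂`. It
is finite on `g₀` but blows up along the sequence at an entry where `A` is nonzero; clearing
denominators gives a continuous function to compare. -/
lemma ConvergesTo.eventually_ne [IsTopologicalRing F] [T2Space F] (h : ConvergesTo g A)
    (hA : A ≠ 0) (hdet : A.det = 0) (g₀ : PGL(2, F)) : ∀ᶠ j in atTop, g j ≠ g₀ := by
  obtain ⟨M, hM, h⟩ := h
  obtain ⟨N, rfl⟩ := Matrix.ProjGenLinGroup.mk_surjective g₀
  obtain ⟨i, k, hik⟩ : ∃ i k, A i k ≠ 0 := by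
    by_contra! h
    exact hA (by ext i k; exact h i k)
  have hc : Continuous fun B : Matrix (Fin 2) (Fin 2) F =>
      B i k ^ 2 * N.1.det - N.1 i k ^ 2 * B.det :=
    (((continuous_id.matrix_elem i k).pow 2).mul continuous_const).sub
      (continuous_const.mul continuous_id.matrix_det)
  have hne : A i k ^ 2 * N.1.det - N.1 i k ^ 2 * A.det ≠ 0 := by
    rw [hdet, mul_zero, sub_zero]
    exact mul_ne_zero (pow_ne_zero 2 hik) N.det_ne_zero
  filter_upwards [((hc.tendsto A).comp h).eventually_ne hne] with j hj heq
  apply hj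
  rw [← hM, Matrix.ProjGenLinGroup.mk_eq_mk_iff] at heq
  obtain ⟨c, rfl⟩ := heq
  simp [Matrix.GeneralLinearGroup.coe_scalar, Matrix.det_fin_two]
  ring

/-- No value recurs forever, so the range is infinite. Choosing indices of infinitely many distinct
values gives an injective `φ`, not necessarily monotone, which therefore tends to infinity. -/
lemma exists_injective_subseq {X : Type*} {g : ℕ → X} (h : ∀ x, ∀ᶠ j in atTop, g j ≠ x) :
    ∃ φ : ℕ → ℕ, Tendsto φ atTop atTop ∧ Function.Injective fun j => g (φ j) := by
  have hinf : (Set.range g).Infinite := by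
    intro hfin
    have := (hfin.eventually_all (l := atTop) (p := fun x j => g j ≠ x)).2 fun x _ => h x
    obtain ⟨j, hj⟩ := this.exists
    exact hj (g j) ⟨j, rfl⟩ rfl
  have e := hinf.natEmbedding
  choose φ hφ using fun n => (e n).2
  have hinj : Function.Injective fun j => g (φ j) := by
    intro a b hab
    simp only [hφ] at hab
    exact e.injective (Subtype.ext hab)
  refine ⟨φ, ?_, hinj⟩
  rw [← Nat.cofinite_eq_atTop]
  exact Function.Injective.tendsto_cofinite fun a b hab => hinj (by simp only [hab])

end Convergence

section Compactness

lemma exists_lift_mem_normalizedMatrices {F : Type*} [Field F] [ValuativeRel F] (g : PGL(2, F)) :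
    ∃ M : GL (Fin 2) F, Matrix.ProjGenLinGroup.mk M = g ∧ M.1 ∈ normalizedMatrices F := by
  obtain ⟨M, rfl⟩ := Matrix.ProjGenLinGroup.mk_surjective g
  obtain ⟨c, hc⟩ := exists_smul_mem_normalizedMatrices (A := M.1) M.ne_zero
  refine ⟨M * .scalar (Fin 2) c, ?_, ?_⟩
  · rw [map_mul, Matrix.ProjGenLinGroup.mk_scalar, mul_one]
  · rwa [coe_mul_scalar]

lemma exists_subseq_convergesTo {S : Type*} [Finite S] {F : S → Type*} [∀ q, Field (F q)]
    [∀ q, ValuativeRel (F q)] [∀ q, TopologicalSpace (F q)]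
    [∀ q, IsNonarchimedeanLocalField (F q)] (γ : ℕ → ∀ q, PGL(2, F q)) :
    ∃ φ : ℕ → ℕ, StrictMono φ ∧ ∀ q, ∃ A, A ≠ 0 ∧ ConvergesTo (fun j => γ (φ j) q) A := by
  choose M hM hMn using fun j q => exists_lift_mem_normalizedMatrices (γ j q)
  have : ∀ q, FirstCountableTopology (Matrix (Fin 2) (Fin 2) (F q)) := fun q =>
    inferInstanceAs (FirstCountableTopology (Fin 2 → Fin 2 → F q))
  have hcpt : IsCompact (Set.univ.pi fun q => normalizedMatrices (F q)) :=
    isCompact_univ_pi fun q => isCompact_normalizedMatrices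
  obtain ⟨A, hA, φ, hφ, hlim⟩ := hcpt.isSeqCompact (x := fun j q => (M j q).1)
    fun j q _ => hMn j q
  refine ⟨φ, hφ, fun q => ⟨A q, ne_zero_of_mem_normalizedMatrices (hA q trivial),
    fun j => M (φ j) q, fun j => hM _ _, ?_⟩⟩
  exact (tendsto_pi_nhds.1 hlim) q

end Compactness

/-! ### The maximal compact subgroup of `PGL₂(F)` -/

section BoundedSubgroup

open ValuativeRel

/-- The matrices in `GL₂(F)` that are a scalar times a matrix in `GL₂(𝒪)`. -/
def integralUpToScalar (F : Type*) [Field F] [ValuativeRel F] : Subgroup (GL (Fin 2) F) where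
  carrier := {M | ∀ i k, valuation F (M.1 i k) ^ 2 ≤ valuation F M.1.det}
  mul_mem' := by
    intro M N hM hN i k
    have key : ∀ l, (valuation F (M.1 i l) * valuation F (N.1 l k)) ^ 2 ≤
        valuation F (M * N).1.det := fun l => by
      rw [mul_pow, Units.val_mul, Matrix.det_mul, map_mul]
      exact mul_le_mul' (hM i l) (hN l k)
    have hmul : (M * N).1 i k = M.1 i 0 * N.1 0 k + M.1 i 1 * N.1 1 k := by
      rw [Units.val_mul, Matrix.mul_apply, Fin.sum_univ_two]
    rw [hmul]
    rcases le_max_iff.1 ((valuation F).map_add (M.1 i 0 * N.1 0 k) (M.1 i 1 * N.1 1 k)) with h | h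
    · exact (pow_le_pow_left' h 2).trans (by simpa using key 0)
    · exact (pow_le_pow_left' h 2).trans (by simpa using key 1)
  one_mem' := by
    intro i k
    fin_cases i <;> fin_cases k <;> simp
  inv_mem' := by
    intro M hM i k
    have hd : valuation F M.1.det ≠ 0 := by simpa using M.det_ne_zero
    have hadj : valuation F (M.1.adjugate i k) ^ 2 ≤ valuation F M.1.det := by
      rw [Matrix.adjugate_fin_two]
      fin_cases i <;> fin_cases k <;> simpa using hM _ _
    rw [Matrix.coe_units_inv, Matrix.det_nonsing_inv, Ring.inverse_eq_inv', map_inv₀,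
      Matrix.inv_def, Ring.inverse_eq_inv', Matrix.smul_apply, smul_eq_mul, map_mul, mul_pow,
      map_inv₀, inv_pow, inv_mul_le_iff₀ (by simpa [zero_lt_iff] using hd),
      pow_two (valuation F M.1.det), mul_assoc, mul_inv_cancel₀ hd, mul_one]
    exact hadj

/-- The image of `GL₂(𝒪)` in `PGL₂(F)`. -/
def integralSubgroup (F : Type*) [Field F] [ValuativeRel F] : Subgroup PGL(2, F) :=
  (integralUpToScalar F).map Matrix.ProjGenLinGroup.mk

lemma mk_mem_integralSubgroup {F : Type*} [Field F] [ValuativeRel F] {M : GL (Fin 2) F} :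
    Matrix.ProjGenLinGroup.mk M ∈ integralSubgroup F ↔
      ∀ i k, valuation F (M.1 i k) ^ 2 ≤ valuation F M.1.det := by
  constructor
  · rintro ⟨N, hN, h⟩ i k
    obtain ⟨c, rfl⟩ := Matrix.ProjGenLinGroup.mk_eq_mk_iff.1 h
    rw [coe_mul_scalar, Matrix.det_smul, Matrix.smul_apply, smul_eq_mul, map_mul, map_mul, map_pow, mul_pow,
      Fintype.card_fin]
    exact mul_le_mul' le_rfl (hN i k)
  · exact fun h => ⟨M, h, rfl⟩

variable {F : Type*} [Field F] [ValuativeRel F] [TopologicalSpace F]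
  [IsNonarchimedeanLocalField F] {g : ℕ → PGL(2, F)} {A : Matrix (Fin 2) (Fin 2) F}

open WithZeroTopology in
lemma isClosed_setOf_valuation_le : IsClosed {x : F × F | valuation F x.1 ≤ valuation F x.2} :=
  isClosed_le (IsValuativeTopology.continuous_valuation.comp continuous_fst)
    (IsValuativeTopology.continuous_valuation.comp continuous_snd)

/-- The inequality `v(M i k)² ≤ v(det M)` is closed, so it passes to the limit, where a nonzero
entry forces a nonzero determinant. -/
lemma ConvergesTo.det_ne_zero_of_mem_integralSubgroup (h : ConvergesTo g A) (hA : A ≠ 0)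
    (hg : ∀ j, g j ∈ integralSubgroup F) : A.det ≠ 0 := by
  obtain ⟨M, hM, h⟩ := h
  obtain ⟨i, k, hik⟩ : ∃ i k, A i k ≠ 0 := by
    by_contra! h
    exact hA (by ext i k; exact h i k)
  have hc : Continuous fun B : Matrix (Fin 2) (Fin 2) F => (B i k ^ 2, B.det) :=
    ((continuous_id.matrix_elem i k).pow 2).prodMk continuous_id.matrix_det
  have := isClosed_setOf_valuation_le.mem_of_tendsto ((hc.tendsto A).comp h) (.of_forall fun j => by
    have := mk_mem_integralSubgroup.1 (hM j ▸ hg j) i k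
    simpa using this)
  intro hdet
  simp [hdet, hik] at this

open WithZeroTopology in
lemma ConvergesTo.exists_mul_inv_mem_integralSubgroup (h : ConvergesTo g A) (hA : A.det ≠ 0) :
    ∀ᶠ k in atTop, ∀ j ≥ k, g j * (g k)⁻¹ ∈ integralSubgroup F := by
  obtain ⟨M, hM, h⟩ := h
  -- `M j * adj (M k)` represents `g j * (g k)⁻¹` and tends to `det A • 1` as `j, k → ∞`. `U` is a
  -- neighbourhood of this limit on which the integrality inequality holds.
  let U : Set (Matrix (Fin 2) (Fin 2) F) :=
    {B | (∀ i k, valuation F (B i k) ≤ valuation F A.det) ∧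
      valuation F B.det = valuation F A.det ^ 2}
  have hU : U ∈ 𝓝 (A.det • (1 : Matrix (Fin 2) (Fin 2) F)) := by
    have hd : valuation F A.det ≠ 0 := by simpa using hA
    have ho1 : IsOpen {x : F | valuation F x ≤ valuation F A.det} := by
      refine IsOpen.preimage IsValuativeTopology.continuous_valuation
        (WithZeroTopology.isOpen_iff (s := Set.Iic (valuation F A.det)).2 (.inr ?_))
      exact ⟨_, hd, Set.Iio_subset_Iic_self⟩
    have ho2 : IsOpen {x : F | valuation F x = valuation F A.det ^ 2} := by
      refine IsOpen.preimage IsValuativeTopology.continuous_valuation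
        (WithZeroTopology.isOpen_iff (s := {valuation F A.det ^ 2}).2 (.inl ?_))
      exact fun h => pow_ne_zero 2 hd h.symm
    have hopen : IsOpen U := by
      have : U = (⋂ i, ⋂ k, (fun B : Matrix (Fin 2) (Fin 2) F => B i k) ⁻¹'
          {x : F | valuation F x ≤ valuation F A.det}) ∩
          Matrix.det ⁻¹' {x : F | valuation F x = valuation F A.det ^ 2} := by
        ext B
        simp [U]
      rw [this]
      exact (isOpen_iInter_of_finite fun i => isOpen_iInter_of_finite fun k =>
        ho1.preimage (continuous_id.matrix_elem i k)).inter (ho2.preimage continuous_id.matrix_det)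
    refine hopen.mem_nhds ⟨fun i k => ?_, ?_⟩
    · fin_cases i <;> fin_cases k <;> simp
    · simp
  have hc : Continuous fun B : Matrix (Fin 2) (Fin 2) F × Matrix (Fin 2) (Fin 2) F =>
      B.1 * B.2.adjugate := continuous_fst.matrix_mul continuous_snd.matrix_adjugate
  have hlim : Tendsto (fun x : ℕ × ℕ => (M x.1).1 * (M x.2).1.adjugate) (atTop ×ˢ atTop)
      (𝓝 (A.det • (1 : Matrix (Fin 2) (Fin 2) F))) := by
    have h2 := (hc.tendsto (A, A)).comp
      ((h.comp (tendsto_fst (g := atTop))).prodMk_nhds (h.comp (tendsto_snd (f := atTop))))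
    simpa only [Matrix.mul_adjugate, Function.comp_def] using h2
  rw [prod_atTop_atTop_eq] at hlim
  obtain ⟨⟨a, b⟩, hab⟩ := eventually_atTop.1 (hlim.eventually hU)
  filter_upwards [eventually_ge_atTop (max a b)] with k hk j hj
  obtain ⟨hB1, hB2⟩ := hab (j, k) ⟨(le_max_left a b).trans (hk.trans hj),
    (le_max_right a b).trans hk⟩
  have hadj : (M k).1.adjugate.det ≠ 0 := by
    rw [Matrix.det_adjugate]
    simpa using (M k).det_ne_zero
  have hmk : g j * (g k)⁻¹ =
      .mk (M j * Matrix.GeneralLinearGroup.mkOfDetNeZero _ hadj) := by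
    rw [map_mul, hM, mul_right_inj, ← hM, ← map_inv, Matrix.ProjGenLinGroup.mk_eq_mk_iff]
    refine ⟨Units.mk0 _ (M k).det_ne_zero, ?_⟩
    ext1
    rw [coe_mul_scalar, Matrix.coe_units_inv, Matrix.inv_def, Ring.inverse_eq_inv', smul_smul,
      Units.val_mk0, mul_inv_cancel₀ (M k).det_ne_zero, one_smul]
    rfl
  rw [hmk, mk_mem_integralSubgroup]
  intro i l
  change valuation F (((M j).1 * (M k).1.adjugate) i l) ^ 2 ≤
    valuation F ((M j).1 * (M k).1.adjugate).det
  rw [hB2]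
  exact pow_le_pow_left' (hB1 i l) 2

end BoundedSubgroup

/-! ### Attractors of a subgroup of `PGL₂(F)` -/

section Attractors

lemma incl_id {F : Type*} [Field F] (x : ProjLine F) : ProjLine.incl (RingHom.id F) x = x := by
  induction x using Projectivization.ind with | _ v hv => rfl

/-- The matrices in `GL₂(F)` whose class lies in `G`. -/
def cone {F : Type*} [Field F] (G : Subgroup PGL(2, F)) : Set (Matrix (Fin 2) (Fin 2) F) :=
  {A | ∃ M : GL (Fin 2) F, .mk M ∈ G ∧ M.1 = A}

/-- The images of the matrices of rank one that are limits of matrices representing elements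
of `G`. -/
def attractors {F : Type*} [Field F] [TopologicalSpace F] (G : Subgroup PGL(2, F)) : Set (ProjLine F) :=
  {x | ∃ u w, ∃ hu : u ≠ 0, w ≠ 0 ∧ Matrix.vecMulVec u w ∈ closure (cone G) ∧
    Projectivization.mk F u hu = x}

open ValuativeRel

variable {F : Type*} [Field F] [ValuativeRel F] [TopologicalSpace F]
  [IsNonarchimedeanLocalField F]

instance : FirstCountableTopology (Matrix (Fin 2) (Fin 2) F) :=
  inferInstanceAs (FirstCountableTopology (Fin 2 → Fin 2 → F))

lemma ConvergesTo.tendsto_smul_of_ne_rot {g : ℕ → PGL(2, F)} {u w : Fin 2 → F}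
    (h : ConvergesTo g (Matrix.vecMulVec u w)) (hu : u ≠ 0) (hw : w ≠ 0) {y : ProjLine F}
    (hy : y ≠ Projectivization.mk F (rot w) (rot_ne_zero hw)) :
    Tendsto (fun j => g j • y) atTop (𝓝 (Projectivization.mk F u hu)) := by
  have := h.tendsto_smul_of_ne (f := RingHom.id F) continuous_id hu hw (y := y)
    (by rwa [incl_id])
  simpa only [incl_id, Matrix.ProjGenLinGroup.map_id, MonoidHom.id_apply] using this

variable {G : Subgroup PGL(2, F)} {A : Matrix (Fin 2) (Fin 2) F}

lemma mem_closure_cone_iff :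
    A ∈ closure (cone G) ↔ ∃ g : ℕ → PGL(2, F), (∀ j, g j ∈ G) ∧ ConvergesTo g A := by
  rw [mem_closure_iff_seq_limit]
  constructor
  · rintro ⟨B, hB, h⟩
    choose M hM hMB using hB
    exact ⟨fun j => .mk (M j), hM, M, fun j => rfl, by simpa only [hMB] using h⟩
  · rintro ⟨g, hg, M, hM, h⟩
    exact ⟨fun j => (M j).1, fun j => ⟨M j, by rw [hM]; exact hg j, rfl⟩, h⟩

lemma smul_mem_closure_cone (hA : A ∈ closure (cone G)) (c : Fˣ) :
    (c : F) • A ∈ closure (cone G) := by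
  refine map_mem_closure (f := fun B : Matrix (Fin 2) (Fin 2) F => (c : F) • B)
    (continuous_id.const_smul (c : F)) hA ?_
  rintro _ ⟨M, hM, rfl⟩
  exact ⟨M * .scalar (Fin 2) c, by simpa using hM, coe_mul_scalar M c⟩

lemma mul_mem_closure_cone (hA : A ∈ closure (cone G)) {M : GL (Fin 2) F}
    (hM : Matrix.ProjGenLinGroup.mk M ∈ G) : M.1 * A ∈ closure (cone G) := by
  refine map_mem_closure (f := fun B : Matrix (Fin 2) (Fin 2) F => M.1 * B)
    (continuous_const.matrix_mul continuous_id) hA ?_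
  rintro _ ⟨N, hN, rfl⟩
  exact ⟨M * N, by simpa using mul_mem hM hN, rfl⟩

lemma adjugate_mem_closure_cone (hA : A ∈ closure (cone G)) :
    A.adjugate ∈ closure (cone G) := by
  refine map_mem_closure (f := Matrix.adjugate) continuous_id.matrix_adjugate hA ?_
  rintro _ ⟨M, hM, rfl⟩
  refine ⟨M⁻¹ * .scalar (Fin 2) (.mk0 _ M.det_ne_zero), ?_, ?_⟩
  · simpa using hM
  · rw [coe_mul_scalar, Matrix.coe_units_inv, Matrix.inv_def, Ring.inverse_eq_inv', smul_smul,
      Units.val_mk0, mul_inv_cancel₀ M.det_ne_zero, one_smul]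

lemma mk_rot_mem_attractors {u w : Fin 2 → F} (hu : u ≠ 0) (hw : w ≠ 0)
    (h : Matrix.vecMulVec u w ∈ closure (cone G)) :
    Projectivization.mk F (rot w) (rot_ne_zero hw) ∈ attractors G :=
  ⟨rot w, rot u, rot_ne_zero hw, rot_ne_zero hu, by
    rw [← adjugate_vecMulVec]; exact adjugate_mem_closure_cone h, rfl⟩

lemma smul_mem_attractors {g : PGL(2, F)} (hg : g ∈ G) {x : ProjLine F} (hx : x ∈ attractors G) :
    g • x ∈ attractors G := by
  obtain ⟨M, rfl⟩ := Matrix.ProjGenLinGroup.mk_surjective g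
  obtain ⟨u, w, hu, hw, h, rfl⟩ := hx
  refine ⟨M • u, w, (smul_ne_zero_iff_ne M).2 hu, hw, ?_, rfl⟩
  change Matrix.vecMulVec (M.1 *ᵥ u) w ∈ _
  rw [← Matrix.mul_vecMulVec]
  exact mul_mem_closure_cone h hg

/-- Scaling `u` and `w` separately to normalized vectors presents the attractors as a continuous
image of a compact set. -/
lemma isClosed_attractors (G : Subgroup PGL(2, F)) : IsClosed (attractors G) := by
  let T : Set ((Fin 2 → F) × (Fin 2 → F)) := (normalizedVectors F ×ˢ normalizedVectors F) ∩
    {p | Matrix.vecMulVec p.1 p.2 ∈ closure (cone G)}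
  have hT : IsCompact T := (isCompact_normalizedVectors.prod isCompact_normalizedVectors).inter_right
    (isClosed_closure.preimage (continuous_fst.matrix_vecMulVec continuous_snd))
  have : CompactSpace T := isCompact_iff_compactSpace.1 hT
  let f : T → ProjLine F := fun p =>
    Projectivization.mk' F ⟨p.1.1, ne_zero_of_mem_normalizedVectors p.2.1.1⟩
  have hf : Continuous f := by
    have hc : Continuous (Projectivization.mk' F : {v : Fin 2 → F // v ≠ 0} → ProjLine F) :=
      continuous_coinduced_rng
    exact hc.comp ((continuous_fst.comp continuous_subtype_val).subtype_mk _)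
  have hrange : attractors G = Set.range f := by
    ext x
    constructor
    · rintro ⟨u, w, hu, hw, h, rfl⟩
      obtain ⟨c, hc⟩ := exists_smul_mem_normalizedVectors hu
      obtain ⟨d, hd⟩ := exists_smul_mem_normalizedVectors hw
      refine ⟨⟨(c • u, d • w), ⟨hc, hd⟩, ?_⟩, (Projectivization.mk_eq_mk_iff F _ _ _ _).2 ⟨c, rfl⟩⟩
      have : Matrix.vecMulVec (c • u) (d • w) = ((c * d : Fˣ) : F) • Matrix.vecMulVec u w := by
        ext i k
        simp only [Matrix.vecMulVec_apply, Matrix.smul_apply, Pi.smul_apply, Units.smul_def,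
          smul_eq_mul, Units.val_mul]
        ring
      change Matrix.vecMulVec (c • u) (d • w) ∈ closure (cone G)
      rw [this]
      exact smul_mem_closure_cone h _
    · rintro ⟨⟨⟨u, w⟩, ⟨hu, hw⟩, h⟩, rfl⟩
      exact ⟨u, w, _, ne_zero_of_mem_normalizedVectors hw, h, rfl⟩
  rw [hrange]
  exact (isCompact_range hf).isClosed

/-- Two distinct attractors `c`, `d` off the repelling point are both moved into any given
neighbourhood of `u`. By injectivity their images cannot both equal `u`. -/
lemma perfect_attractors
    (h : ∀ b, ∃ c ∈ attractors G, ∃ d ∈ attractors G, c ≠ d ∧ c ≠ b ∧ d ≠ b) :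
    Perfect (attractors G) := by
  refine ⟨isClosed_attractors G, ?_⟩
  rintro x ⟨u, w, hu, hw, hA, rfl⟩
  obtain ⟨g, hg, hgA⟩ := mem_closure_cone_iff.1 hA
  obtain ⟨c, hc, d, hd, hcd, hcb, hdb⟩ := h (Projectivization.mk F (rot w) (rot_ne_zero hw))
  rw [accPt_iff_nhds]
  intro U hU
  obtain ⟨j, hj1, hj2⟩ := (((hgA.tendsto_smul_of_ne_rot hu hw hcb).eventually hU).and
    ((hgA.tendsto_smul_of_ne_rot hu hw hdb).eventually hU)).exists
  by_cases hne : g j • c = Projectivization.mk F u hu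
  · refine ⟨g j • d, ⟨hj2, smul_mem_attractors (hg j) hd⟩, fun h => hcd ?_⟩
    exact smul_left_cancel (g j) (hne.trans h.symm)
  · exact ⟨g j • c, ⟨hj1, smul_mem_attractors (hg j) hc⟩, hne⟩

end Attractors

/-! ### A single attractor is impossible in characteristic zero -/

section Parabolic

lemma exists_firstCol_eq {F : Type*} [Field F] {u : Fin 2 → F} (hu : u ≠ 0) :
    ∃ P : GL (Fin 2) F, P.1 *ᵥ ![1, 0] = u := by
  by_cases h0 : u 0 = 0
  · have h1 : u 1 ≠ 0 := fun h1 => hu (by ext k; fin_cases k <;> simp [h0, h1])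
    refine ⟨Matrix.GeneralLinearGroup.mkOfDetNeZero !![u 0, 1; u 1, 0] (by simpa using h1), ?_⟩
    ext k
    fin_cases k <;> simp [Matrix.GeneralLinearGroup.mkOfDetNeZero, Matrix.mulVec, dotProduct]
  · refine ⟨Matrix.GeneralLinearGroup.mkOfDetNeZero !![u 0, 0; u 1, 1] (by simpa using h0), ?_⟩
    ext k
    fin_cases k <;> simp [Matrix.GeneralLinearGroup.mkOfDetNeZero, Matrix.mulVec, dotProduct]

open ValuativeRel

variable {F : Type*} [Field F] [ValuativeRel F] [TopologicalSpace F]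
  [IsNonarchimedeanLocalField F]

/-- The powers of the translation by `b` are the translations by `n b`, all inside the compact ball
of radius `v(b)`. If `b ≠ 0` they are pairwise distinct in characteristic zero, and a convergent
subsequence contradicts discreteness. -/
lemma eq_zero_of_translation_mem [CharZero F] {Z : Subgroup (GL (Fin 2) F)}
    (hdisc : ∀ (M : ℕ → GL (Fin 2) F) (A : Matrix (Fin 2) (Fin 2) F), (∀ j, M j ∈ Z) →
      Tendsto (fun j => (M j).1) atTop (𝓝 A) → A.det ≠ 0 →
      ∃ j k, j ≠ k ∧ Matrix.ProjGenLinGroup.mk (M j) = .mk (M k))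
    {N : GL (Fin 2) F} (hN : N ∈ Z) {b : F} (hb : N.1 = !![1, b; 0, 1]) : b = 0 := by
  have hpow : ∀ n : ℕ, (N ^ n).1 = !![1, (n : F) * b; 0, 1] := by
    intro n
    induction n with
    | zero => simp [Matrix.one_fin_two]
    | succ n ih =>
      rw [pow_succ, Units.val_mul, ih, hb]
      ext i k
      fin_cases i <;> fin_cases k <;> simp
      ring
  have hcpt := IsNonarchimedeanLocalField.isCompact_closedBall F (valuation F b)
  obtain ⟨x, -, φ, hφ, hlim⟩ := hcpt.isSeqCompact (x := fun n : ℕ => (n : F) * b) fun n => by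
    have hn : valuation F (n : F) ≤ 1 := natCast_mem (𝒪[F]) n
    change valuation F ((n : F) * b) ≤ valuation F b
    rw [map_mul]
    exact mul_le_of_le_one_left' hn
  have hc : Continuous fun y : F => (!![1, y; 0, 1] : Matrix (Fin 2) (Fin 2) F) := by
    refine continuous_matrix fun i k => ?_
    fin_cases i <;> fin_cases k
    · exact continuous_const
    · exact continuous_id
    · exact continuous_const
    · exact continuous_const
  obtain ⟨j, k, hjk, heq⟩ := hdisc (fun j => N ^ φ j) !![1, x; 0, 1] (fun j => pow_mem hN _)
    (by simpa only [hpow, Function.comp_def] using (hc.tendsto x).comp hlim) (by simp)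
  obtain ⟨c, hc⟩ := Matrix.ProjGenLinGroup.mk_eq_mk_iff.1 heq
  have hc' : (c : F) • (N ^ φ j).1 = (N ^ φ k).1 := by rw [← coe_mul_scalar, hc]
  rw [hpow, hpow] at hc'
  have h00 : (c : F) = 1 := by simpa using congrFun (congrFun hc' 0) 0
  have h01 : (φ j : F) * b = φ k * b := by simpa [h00] using congrFun (congrFun hc' 0) 1
  by_contra hb0
  exact hjk (hφ.injective (Nat.cast_injective (R := F) (mul_right_cancel₀ hb0 h01)))

lemma notMem_closure_of_upperTriangular [CharZero F] {Z : Subgroup (GL (Fin 2) F)}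
    (hscalar : ∀ c, .scalar (Fin 2) c ∈ Z) (htri : ∀ M ∈ Z, M.1 1 0 = 0)
    (hdisc : ∀ (M : ℕ → GL (Fin 2) F) (A : Matrix (Fin 2) (Fin 2) F), (∀ j, M j ∈ Z) →
      Tendsto (fun j => (M j).1) atTop (𝓝 A) → A.det ≠ 0 →
      ∃ j k, j ≠ k ∧ Matrix.ProjGenLinGroup.mk (M j) = .mk (M k))
    {s : F} (hs : s ≠ 0) : !![0, s; 0, 0] ∉ closure ((fun M : GL (Fin 2) F => M.1) '' Z) := by
  intro hE
  have hdiag : ∀ M ∈ Z, M.1 0 0 ≠ 0 ∧ M.1 1 1 ≠ 0 := by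
    intro M hM
    have := M.det_ne_zero
    rw [Matrix.det_fin_two, htri M hM, mul_zero, sub_zero] at this
    exact mul_ne_zero_iff.1 this
  -- The commutator of two upper triangular matrices is a translation, hence trivial. The displayed
  -- equality is the upper right entry of `M N = N M`.
  have hcomm : ∀ M ∈ Z, ∀ N ∈ Z, M.1 0 0 * N.1 0 1 + M.1 0 1 * N.1 1 1 =
      N.1 0 0 * M.1 0 1 + N.1 0 1 * M.1 1 1 := by
    intro M hM N hN
    let T := M * N * (N * M)⁻¹
    have hT : T ∈ Z := mul_mem (mul_mem hM hN) (inv_mem (mul_mem hN hM))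
    have hmul : T.1 * (N.1 * M.1) = M.1 * N.1 := by
      rw [← Units.val_mul, ← Units.val_mul, ← Units.val_mul, inv_mul_cancel_right]
    have e : ∀ i k, (T.1 * (N.1 * M.1)) i k = (M.1 * N.1) i k := fun i k => by rw [hmul]
    simp only [Matrix.mul_apply, Fin.sum_univ_two] at e
    have e00 := e 0 0
    have e01 := e 0 1
    have e11 := e 1 1
    simp only [htri _ hT, htri _ hM, htri _ hN, mul_zero, zero_mul, add_zero, zero_add]
      at e00 e01 e11
    obtain ⟨hM0, hM1⟩ := hdiag M hM
    obtain ⟨hN0, hN1⟩ := hdiag N hN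
    have t00 : T.1 0 0 = 1 := by
      apply mul_right_cancel₀ (mul_ne_zero hN0 hM0)
      rw [e00]; ring
    have t11 : T.1 1 1 = 1 := by
      apply mul_right_cancel₀ (mul_ne_zero hN1 hM1)
      rw [e11]; ring
    have t01 : T.1 0 1 = 0 := by
      refine eq_zero_of_translation_mem hdisc hT ?_
      ext i k
      fin_cases i <;> fin_cases k <;> simp [t00, t11, htri _ hT]
    rw [t00, t01] at e01
    linear_combination -e01
  -- Commuting with `M` is a closed condition, so it holds for the nilpotent limit; this forces
  -- equal diagonal entries.
  have hdiag_eq : ∀ M ∈ Z, M.1 0 0 = M.1 1 1 := by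
    intro M hM
    have hcl : IsClosed {B : Matrix (Fin 2) (Fin 2) F | M.1 0 0 * B 0 1 + M.1 0 1 * B 1 1 =
        B 0 0 * M.1 0 1 + B 0 1 * M.1 1 1} := by
      have hc : ∀ i k, Continuous fun B : Matrix (Fin 2) (Fin 2) F => B i k :=
        fun i k => continuous_id.matrix_elem i k
      exact isClosed_eq ((continuous_const.mul (hc _ _)).add (continuous_const.mul (hc _ _)))
        (((hc _ _).mul continuous_const).add ((hc _ _).mul continuous_const))
    have := closure_minimal (by rintro _ ⟨N, hN, rfl⟩; exact hcomm M hM N hN) hcl hE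
    apply mul_left_cancel₀ hs
    simp at this
    linear_combination this
  -- Dividing `M` by its diagonal entry gives a translation in `Z`, which is trivial.
  have hzero : ∀ M ∈ Z, M.1 0 1 = 0 := by
    intro M hM
    obtain ⟨h0, -⟩ := hdiag M hM
    have := eq_zero_of_translation_mem hdisc (mul_mem hM (hscalar (Units.mk0 _ h0)⁻¹))
      (b := (M.1 0 0)⁻¹ * M.1 0 1) (by
        rw [coe_mul_scalar]
        ext i k
        fin_cases i <;> fin_cases k <;> simp [h0, htri M hM, ← hdiag_eq M hM])
    simpa [h0] using this
  have hcl : IsClosed {B : Matrix (Fin 2) (Fin 2) F | B 0 1 = 0} :=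
    isClosed_eq (continuous_id.matrix_elem 0 1) continuous_const
  have := closure_minimal (by rintro _ ⟨N, hN, rfl⟩; exact hzero N hN) hcl hE
  exact hs (by simpa using this)

/-- With `x` the only attractor, `rot w = u`, so the limit `u wᵀ` is nilpotent, and `G` fixes `x`.
Moving `x` to the first basis vector reduces to the upper triangular case. -/
lemma attractors_ne_singleton [CharZero F] {G : Subgroup PGL(2, F)}
    (hdisc : ∀ (g : ℕ → PGL(2, F)) (A : Matrix (Fin 2) (Fin 2) F), (∀ j, g j ∈ G) →
      ConvergesTo g A → A.det ≠ 0 → ¬ Function.Injective g) (x : ProjLine F) :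
    attractors G ≠ {x} := by
  intro hG
  obtain ⟨u, w, hu, hw, hA, hux⟩ : x ∈ attractors G := by rw [hG]; rfl
  have hrot : Projectivization.mk F (rot w) (rot_ne_zero hw) = Projectivization.mk F u hu := by
    have := mk_rot_mem_attractors hu hw hA
    rw [hG] at this
    exact this.trans hux.symm
  have hwu : w ⬝ᵥ u = 0 := by
    rw [mk_eq_mk_iff_det] at hrot
    simp only [rot, Matrix.cons_val_zero, Matrix.cons_val_one] at hrot
    simp only [dotProduct, Fin.sum_univ_two]
    linear_combination -hrot
  obtain ⟨P, hP⟩ := exists_firstCol_eq hu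
  have hP' : P⁻¹.1 *ᵥ u = ![1, 0] := by
    rw [← hP, Matrix.mulVec_mulVec, ← Units.val_mul, inv_mul_cancel, Units.val_one,
      Matrix.one_mulVec]
  let Z : Subgroup (GL (Fin 2) F) := (G.comap Matrix.ProjGenLinGroup.mk).comap
    (MulAut.conj P).toMonoidHom
  have hmem : ∀ N, N ∈ Z ↔ Matrix.ProjGenLinGroup.mk (P * N * P⁻¹) ∈ G := fun N => Iff.rfl
  have hw0 : w ᵥ* P.1 ≠ 0 := by
    intro h
    apply hw
    rw [← Matrix.vecMul_one w, ← Units.val_one, ← mul_inv_cancel P, Units.val_mul,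
      ← Matrix.vecMul_vecMul, h, Matrix.zero_vecMul]
  have hw1 : (w ᵥ* P.1) 0 = 0 := by
    rw [← hP, Matrix.dotProduct_mulVec] at hwu
    simpa [dotProduct] using hwu
  have hs : (w ᵥ* P.1) 1 ≠ 0 := fun h => hw0 (by ext k; fin_cases k <;> simp [hw1, h])
  refine notMem_closure_of_upperTriangular (Z := Z) (fun c => ?_) (fun N hN => ?_)
    (fun M A hM hMA hA => ?_) hs ?_
  · rw [hmem]
    simp
  · rw [hmem] at hN
    have := smul_mem_attractors hN (x := x) (by rw [hG]; rfl)
    rw [hG, ← hux] at this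
    have h2 := (Projectivization.mk_eq_mk_iff' F _ _ _ _).1 this
    obtain ⟨a, ha⟩ := h2
    have h3 : a • u = (P * N * P⁻¹).1 *ᵥ u := ha
    have h4 : N.1 *ᵥ ![1, 0] = a • ![1, 0] := by
      rw [← hP', ← Matrix.mulVec_smul, h3, Matrix.mulVec_mulVec, Matrix.mulVec_mulVec,
        ← Units.val_mul, ← Units.val_mul]
      group
    simpa [Matrix.mulVec, dotProduct] using congrFun h4 1
  · have hconv : ConvergesTo (fun j => .mk (P * M j * P⁻¹)) (P.1 * A * P⁻¹.1) :=
      ⟨_, fun j => rfl, by simpa using (hMA.const_mul P.1).mul_const P⁻¹.1⟩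
    have := hdisc _ _ (fun j => (hmem _).1 (hM j)) hconv (by
      rw [Matrix.det_mul, Matrix.det_mul]
      exact mul_ne_zero (mul_ne_zero P.det_ne_zero hA) P⁻¹.det_ne_zero)
    simp only [Function.Injective, not_forall] at this
    obtain ⟨j, k, hjk, hne⟩ := this
    refine ⟨j, k, hne, ?_⟩
    simpa using hjk
  · have h1 : !![0, (w ᵥ* P.1) 1; 0, 0] = P⁻¹.1 * Matrix.vecMulVec u w * P.1 := by
      rw [Matrix.mul_vecMulVec, Matrix.vecMulVec_mul, hP']
      ext i k
      fin_cases i <;> fin_cases k <;> simp [Matrix.vecMulVec_apply, hw1]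
    rw [h1]
    refine map_mem_closure (f := fun B : Matrix (Fin 2) (Fin 2) F => P⁻¹.1 * B * P.1)
      ((continuous_const.matrix_mul continuous_id).matrix_mul continuous_const) hA ?_
    rintro _ ⟨M, hM, rfl⟩
    refine ⟨P⁻¹ * M * P, ?_, by simp⟩
    change _ ∈ Z
    rw [hmem]
    convert hM using 2
    group

end Parabolic

/-! ### The embeddings into `𝐂` are not surjective -/

section NotSurjective

open ValuativeRel

variable {F : Type*} [Field F] [ValuativeRel F] [TopologicalSpace F]
  [IsNonarchimedeanLocalField F]

lemma valuation_eq_one_of_forall_exists_pow_eq {y : F} (hy : y ≠ 0)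
    (h : ∀ n : ℕ, 0 < n → ∃ t, t ^ n = y) : valuation F y = 1 := by
  let e := IsNonarchimedeanLocalField.valueGroupWithZeroIsoInt F
  have he : e (valuation F y) ≠ 0 := by simpa using hy
  have hlog : WithZero.log (e (valuation F y)) = 0 := by
    -- The value group is `ℤ`, and an integer `m` divisible by `|m| + 1` is zero.
    obtain ⟨t, ht⟩ := h ((WithZero.log (e (valuation F y))).natAbs + 1) (Nat.succ_pos _)
    have h2 : WithZero.log (e (valuation F y)) =
        (((WithZero.log (e (valuation F y))).natAbs + 1 : ℕ) : ℤ) *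
          WithZero.log (e (valuation F t)) := by
      conv_lhs => rw [← ht, map_pow, map_pow, WithZero.log_pow]
      simp
    refine Int.eq_zero_of_abs_lt_dvd ⟨_, h2⟩ ?_
    rw [Int.abs_eq_natAbs]
    exact_mod_cast Nat.lt_succ_self _
  have h1 : e (valuation F y) = 1 := by
    rw [← WithZero.exp_log he, hlog, WithZero.exp_zero]
  exact e.injective (h1.trans (map_one e).symm)

open WithZeroTopology in
-- The powers of a unit stay in a compact set and accumulate only at units, which `f` does not send
-- to `0`. Only continuity of `f` is used, not compatibility with absolute values.
lemma not_tendsto_map_pow_zero {C : Type*} [Field C] [TopologicalSpace C] [T2Space C]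
    {f : F →+* C} (hf : Continuous f) {y : F} (hy : valuation F y = 1) :
    ¬ Tendsto (fun n : ℕ => f y ^ n) atTop (𝓝 0) := by
  intro h
  have hcpt := IsNonarchimedeanLocalField.isCompact_closedBall F 1
  obtain ⟨z, -, φ, hφ, hlim⟩ := hcpt.isSeqCompact (x := fun n : ℕ => y ^ n) fun n => by
    simp [hy]
  have h0 : f z = 0 := tendsto_nhds_unique ((hf.tendsto z).comp hlim)
    ((h.comp hφ.tendsto_atTop).congr fun n => by simp)
  have hz : z = 0 := by simpa using h0
  have h1 := (IsValuativeTopology.continuous_valuation.tendsto z).comp hlim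
  have h2 : valuation F z = 1 := tendsto_nhds_unique h1
    (tendsto_const_nhds.congr fun n => by simp [hy])
  simp [hz] at h2

/-- A nonzero `x ∈ K` with `‖x‖ < 1` has roots of all orders in `𝐂`. Under surjectivity its preimage
would be a unit, yet the powers of `x` tend to zero. -/
lemma not_surjective_completedAlgCl {K : Type*} [NontriviallyNormedField K] [IsUltrametricDist K]
    [CompleteSpace K] {f : F →+* CompletedAlgCl K} (hf : Continuous f) :
    ¬ Function.Surjective f := by
  intro hsurj
  obtain ⟨x, hx0, hx1⟩ := NormedField.exists_norm_lt_one K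
  have : IsAlgClosed (AlgCl K) := IsAlgClosure.isAlgClosed K
  let coe : AlgCl K →+* CompletedAlgCl K := UniformSpace.Completion.coeRingHom
  let a : AlgCl K := algebraMap K (AlgCl K) x
  have hcoe : ∀ z : AlgCl K, ‖coe z‖ = ‖z‖ := fun z => UniformSpace.Completion.norm_coe z
  have ha : ‖coe a‖ = ‖x‖ := by
    rw [hcoe]
    exact norm_algebraMap' (AlgCl K) x
  obtain ⟨y, hy⟩ := hsurj (coe a)
  have hy0 : y ≠ 0 := by
    rintro rfl
    rw [map_zero] at hy
    rw [← hy, norm_zero] at ha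
    exact hx0.ne ha
  have hval : valuation F y = 1 := by
    refine valuation_eq_one_of_forall_exists_pow_eq hy0 fun n hn => ?_
    obtain ⟨z, hz⟩ := IsAlgClosed.exists_pow_nat_eq a hn
    obtain ⟨t, ht⟩ := hsurj (coe z)
    refine ⟨t, f.injective ?_⟩
    rw [map_pow, ht, ← map_pow, hz, hy]
  refine not_tendsto_map_pow_zero hf hval ?_
  rw [hy]
  exact tendsto_pow_atTop_nhds_zero_of_norm_lt_one (ha.trans_lt hx1)

lemma charP_or_charZero_of_residueField (p : ℕ) [Fact p.Prime] (F : Type*) [Field F]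
    [ValuativeRel F] [CharP 𝓀[F] p] : CharP F p ∨ CharZero F := by
  obtain ⟨r, hr⟩ := CharP.exists F
  rcases CharP.char_is_prime_or_zero F r with hp | rfl
  · left
    have h0 : ((r : ℕ) : 𝒪[F]) = 0 := Subtype.ext (by simp)
    have h1 : ((r : ℕ) : 𝓀[F]) = 0 := by
      rw [← map_natCast (IsLocalRing.residue 𝒪[F]), h0, map_zero]
    have h2 := (CharP.cast_eq_zero_iff 𝓀[F] p r).1 h1
    rwa [(Nat.prime_dvd_prime_iff_eq Fact.out hp).1 h2]
  · exact .inr (CharP.charP_to_charZero F)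

end NotSurjective

/-! ### Limit sets of a plectic group as attractors -/

section Main

variable {S : Type*} [Finite S] {F : S → Type*} [∀ q, Field (F q)] [∀ q, ValuativeRel (F q)]
  [∀ q, TopologicalSpace (F q)] [∀ q, IsNonarchimedeanLocalField (F q)]
  {C : Type*} [Field C] [TopologicalSpace C] [IsTopologicalRing C]
  {ι : ∀ q, F q →+* C} {Γ : Subgroup (∀ q, PGL(2, F q))} {L : ∀ q, Set (ProjLine (F q))}

/-- The projection to `PGL₂(F_𝔭)` of the elements of `Γ` that are integral away from `𝔭`. -/
def integralAway {S : Type*} {F : S → Type*} [∀ q, Field (F q)] [∀ q, ValuativeRel (F q)]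
    (Γ : Subgroup (∀ q, PGL(2, F q))) (𝔭 : S) : Subgroup PGL(2, F 𝔭) :=
  (Γ ⊓ Subgroup.pi {𝔭}ᶜ fun q => integralSubgroup (F q)).map (Pi.evalMonoidHom _ 𝔭)

lemma mem_integralAway {S : Type*} {F : S → Type*} [∀ q, Field (F q)] [∀ q, ValuativeRel (F q)]
    {Γ : Subgroup (∀ q, PGL(2, F q))} {𝔭 : S} {g : PGL(2, F 𝔭)} :
    g ∈ integralAway Γ 𝔭 ↔
      ∃ γ ∈ Γ, (∀ q ≠ 𝔭, γ q ∈ integralSubgroup (F q)) ∧ γ 𝔭 = g := by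
  simp [integralAway, Subgroup.mem_map, Subgroup.mem_pi, and_assoc]

lemma IsPlecticWith.exists_mem_of_tendsto {S : Type*} {F : S → Type*} [∀ q, Field (F q)]
    {C : Type*} [Field C] [TopologicalSpace C] {ι : ∀ q, F q →+* C}
    {Γ : Subgroup (∀ q, PGL(2, F q))} {L : ∀ q, Set (ProjLine (F q))}
    (hL : IsPlecticWith ι Γ L) {γ : ℕ → ∀ q, PGL(2, F q)} (hinj : Function.Injective γ)
    (hγ : ∀ j, γ j ∈ Γ) {y z : S → ProjLine C}
    (h : ∀ q, Tendsto (fun j => Matrix.ProjGenLinGroup.map (ι q) (γ j q) • y q) atTop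
      (𝓝 (z q))) : ∃ q, z q ∈ ProjLine.incl (ι q) '' L q := by
  have : z ∈ limitSet ι Γ := ⟨y, γ, hinj, hγ, tendsto_pi_nhds.2 h⟩
  rw [hL] at this
  simpa only [Set.mem_iUnion, Set.mem_ofPred_eq] using this

/-- Starting from a point with every coordinate off `ℙ¹(F_q)`, the limit stays off `ℙ¹(F_q)` for `q
≠ 𝔭`, so the plectic condition can hold only at `𝔭`, where the limit is `u`. -/
lemma IsPlecticWith.mk_mem {S : Type*} {F : S → Type*} [∀ q, Field (F q)]
    [∀ q, TopologicalSpace (F q)] {C : Type*} [Field C] [TopologicalSpace C] [IsTopologicalRing C]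
    {ι : ∀ q, F q →+* C} {Γ : Subgroup (∀ q, PGL(2, F q))} {L : ∀ q, Set (ProjLine (F q))}
    (hL : IsPlecticWith ι Γ L) (hι : ∀ q, Continuous (ι q))
    (hsurj : ∀ q, ¬ Function.Surjective (ι q)) {γ : ℕ → ∀ q, PGL(2, F q)}
    (hinj : Function.Injective γ) (hγ : ∀ j, γ j ∈ Γ) {𝔭 : S}
    (hA : ∀ q ≠ 𝔭, ∃ A : Matrix (Fin 2) (Fin 2) (F q), A.det ≠ 0 ∧ ConvergesTo (fun j => γ j q) A)
    {u w : Fin 2 → F 𝔭} (hu : u ≠ 0) (hw : w ≠ 0)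
    (huw : ConvergesTo (fun j => γ j 𝔭) (Matrix.vecMulVec u w)) :
    Projectivization.mk (F 𝔭) u hu ∈ L 𝔭 := by
  choose y hy using fun q => exists_notMem_range_incl (ι q) (hsurj q)
  have key : ∀ q, ∃ z, Tendsto (fun j => Matrix.ProjGenLinGroup.map (ι q) (γ j q) • y q) atTop
      (𝓝 z) ∧ (z ∈ ProjLine.incl (ι q) '' L q → Projectivization.mk (F 𝔭) u hu ∈ L 𝔭) := by
    intro q
    by_cases hq : q = 𝔭
    · subst hq
      refine ⟨_, huw.tendsto_smul_of_ne (hι q) hu hw fun h => hy q ⟨_, h.symm⟩, ?_⟩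
      rintro ⟨x, hx, hxu⟩
      rwa [← incl_injective _ hxu]
    · obtain ⟨A, hdet, hA⟩ := hA q hq
      refine ⟨_, hA.tendsto_smul_of_det_ne_zero (hι q) hdet (y q), ?_⟩
      rintro ⟨x, -, hx⟩
      exact absurd ⟨x, hx⟩ (map_smul_notMem_range_incl _ _ (hy q))
  choose z hz hzL using key
  obtain ⟨q, hq⟩ := hL.exists_mem_of_tendsto hinj hγ hz
  exact hzL q hq

lemma IsPlecticWith.exists_det_eq_zero {S : Type*} {F : S → Type*} [∀ q, Field (F q)]
    [∀ q, TopologicalSpace (F q)] {C : Type*} [Field C] [TopologicalSpace C] [IsTopologicalRing C]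
    {ι : ∀ q, F q →+* C} {Γ : Subgroup (∀ q, PGL(2, F q))} {L : ∀ q, Set (ProjLine (F q))}
    (hL : IsPlecticWith ι Γ L) (hι : ∀ q, Continuous (ι q))
    (hsurj : ∀ q, ¬ Function.Surjective (ι q)) {γ : ℕ → ∀ q, PGL(2, F q)}
    (hinj : Function.Injective γ) (hγ : ∀ j, γ j ∈ Γ) {A : ∀ q, Matrix (Fin 2) (Fin 2) (F q)}
    (hA : ∀ q, ConvergesTo (fun j => γ j q) (A q)) : ∃ q, (A q).det = 0 := by
  by_contra! hdet
  choose y hy using fun q => exists_notMem_range_incl (ι q) (hsurj q)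
  obtain ⟨q, x, -, hx⟩ := hL.exists_mem_of_tendsto hinj hγ
    fun q => (hA q).tendsto_smul_of_det_ne_zero (hι q) (hdet q) (y q)
  exact map_smul_notMem_range_incl _ _ (hy q) ⟨x, hx⟩

/-- Away from `𝔭` the lifts are integral, so a subsequence has invertible limits there too.
Invertible limits at every place are excluded by `IsPlecticWith.exists_det_eq_zero`. -/
lemma IsPlecticWith.not_injective (hL : IsPlecticWith ι Γ L) (hι : ∀ q, Continuous (ι q))
    (hsurj : ∀ q, ¬ Function.Surjective (ι q)) {𝔭 : S} {g : ℕ → PGL(2, F 𝔭)}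
    {A : Matrix (Fin 2) (Fin 2) (F 𝔭)} (hg : ∀ j, g j ∈ integralAway Γ 𝔭)
    (hgA : ConvergesTo g A) (hA : A.det ≠ 0) : ¬ Function.Injective g := by
  intro hinj
  choose γ hγ hint hγg using fun j => mem_integralAway.1 (hg j)
  obtain ⟨φ, hφ, hconv⟩ := exists_subseq_convergesTo γ
  have hconv' : ∀ q, ∃ B, B.det ≠ 0 ∧ ConvergesTo (fun j => γ (φ j) q) B := by
    intro q
    by_cases hq : q = 𝔭
    · subst hq
      exact ⟨A, hA, by simpa only [hγg] using hgA.comp hφ.tendsto_atTop⟩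
    · obtain ⟨B, hB, hBc⟩ := hconv q
      exact ⟨B, hBc.det_ne_zero_of_mem_integralSubgroup hB fun j => hint _ q hq, hBc⟩
  choose B hB hBc using hconv'
  obtain ⟨q, hq⟩ := hL.exists_det_eq_zero hι hsurj (γ := fun j => γ (φ j))
    (fun a b hab => hφ.injective (hinj (by rw [← hγg, ← hγg]; exact congrFun hab 𝔭)))
    (fun j => hγ _) hBc
  exact hB q hq

lemma IsPlecticWith.attractors_subset (hL : IsPlecticWith ι Γ L) (hι : ∀ q, Continuous (ι q))
    (hsurj : ∀ q, ¬ Function.Surjective (ι q)) (𝔭 : S) :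
    attractors (integralAway Γ 𝔭) ⊆ L 𝔭 := by
  rintro x ⟨u, w, hu, hw, hA, rfl⟩
  obtain ⟨g, hg, hgA⟩ := mem_closure_cone_iff.1 hA
  choose γ hγ hint hγg using fun j => mem_integralAway.1 (hg j)
  obtain ⟨φ, hφ, hconv⟩ := exists_subseq_convergesTo γ
  have hgφ := hgA.comp hφ.tendsto_atTop
  obtain ⟨ψ, hψ, hinj⟩ := exists_injective_subseq
    (hgφ.eventually_ne (vecMulVec_ne_zero' hu hw) (det_vecMulVec_two u w))
  refine hL.mk_mem hι hsurj (γ := fun j => γ (φ (ψ j)))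
    (fun a b hab => hinj ?_) (fun j => hγ _) (fun q hq => ?_) hu hw ?_
  · simp only [← hγg]
    exact congrFun hab 𝔭
  · obtain ⟨B, hB, hBc⟩ := hconv q
    exact ⟨B, hBc.det_ne_zero_of_mem_integralSubgroup hB fun j => hint _ q hq, hBc.comp hψ⟩
  · simpa only [hγg] using hgφ.comp hψ

lemma IsPlecticWith.subset_attractors [T2Space C] (hL : IsPlecticWith ι Γ L) (hι : ∀ q, Continuous (ι q))
    (hsurj : ∀ q, ¬ Function.Surjective (ι q)) (𝔭 : S) :
    L 𝔭 ⊆ attractors (integralAway Γ 𝔭) := by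
  classical
  intro x₀ hx₀
  choose y₀ hy₀ using fun q => exists_notMem_range_incl (ι q) (hsurj q)
  -- With all other coordinates off `ℙ¹(F_q)`, this limit point forces degeneration to occur at `𝔭`
  -- alone.
  let x : S → ProjLine C := Function.update y₀ 𝔭 (ProjLine.incl (ι 𝔭) x₀)
  have hx𝔭 : x 𝔭 = ProjLine.incl (ι 𝔭) x₀ := Function.update_self _ _ _
  have hxq : ∀ q ≠ 𝔭, x q ∉ Set.range (ProjLine.incl (ι q)) := by
    intro q hq
    simpa [x, hq] using hy₀ q
  have hx : x ∈ limitSet ι Γ := by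
    rw [hL]
    exact Set.mem_iUnion.2 ⟨𝔭, x₀, hx₀, hx𝔭.symm⟩
  obtain ⟨y, γ₀, hinj₀, hγ₀, hlim₀⟩ := hx
  obtain ⟨φ, hφ, hconv⟩ := exists_subseq_convergesTo γ₀
  choose A hA0 hA using hconv
  obtain ⟨γ, hγdef⟩ : ∃ γ : ℕ → ∀ q, PGL(2, F q), γ = fun j => γ₀ (φ j) := ⟨_, rfl⟩
  have hinj : Function.Injective γ := by
    rw [hγdef]
    exact hinj₀.comp hφ.injective
  have hγ : ∀ j, γ j ∈ Γ := by
    rw [hγdef]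
    exact fun j => hγ₀ _
  have hlim : ∀ q, Tendsto (fun j => Matrix.ProjGenLinGroup.map (ι q) (γ j q) • y q) atTop
      (𝓝 (x q)) := by
    rw [hγdef]
    exact fun q => (tendsto_pi_nhds.1 hlim₀ q).comp hφ.tendsto_atTop
  replace hA : ∀ q, ConvergesTo (fun j => γ j q) (A q) := by
    rw [hγdef]
    exact hA
  have hdet : ∀ q ≠ 𝔭, (A q).det ≠ 0 := by
    intro q hq h0
    obtain ⟨u, w, hu, hw, hAq⟩ := exists_eq_vecMulVec (hA0 q) h0
    have hconv := hA q
    rw [hAq] at hconv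
    apply hxq q hq
    -- At the repelling point the convergence statement fails, but that point is rational, so its
    -- orbit stays in the closed subset `ℙ¹(F_q)`.
    by_cases hy : y q = ProjLine.incl (ι q) (Projectivization.mk (F q) (rot w) (rot_ne_zero hw))
    · refine (isClosedEmbedding_incl (hι q)).isClosed_range.mem_of_tendsto (hlim q)
        (.of_forall fun j => ?_)
      rw [hy, map_smul_incl]
      exact ⟨_, rfl⟩
    · exact ⟨_, tendsto_nhds_unique (hconv.tendsto_smul_of_ne (hι q) hu hw hy) (hlim q)⟩
  have hdet𝔭 : (A 𝔭).det = 0 := by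
    obtain ⟨q, hq⟩ := hL.exists_det_eq_zero hι hsurj hinj hγ hA
    by_cases h : q = 𝔭
    · rwa [h] at hq
    · exact absurd hq (hdet q h)
  obtain ⟨u, w, hu, hw, hA𝔭⟩ := exists_eq_vecMulVec (hA0 𝔭) hdet𝔭
  -- Right multiplication by `(γ k)⁻¹` makes the tail integral away from `𝔭`. The limit is unchanged
  -- once the base point `y 𝔭` is replaced by its image under `γ k`.
  obtain ⟨k, hk⟩ : ∃ k, ∀ q, q ≠ 𝔭 → ∀ j ≥ k, γ j q * (γ k q)⁻¹ ∈ integralSubgroup (F q) := by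
    refine (eventually_all.2 fun q => ?_).exists (f := atTop)
    by_cases hq : q = 𝔭
    · exact .of_forall fun k h => absurd hq h
    · filter_upwards [(hA q).exists_mul_inv_mem_integralSubgroup (hdet q hq)] with k hk _
      exact hk
  obtain ⟨N, hN⟩ := Matrix.ProjGenLinGroup.mk_surjective (γ k 𝔭)⁻¹
  have hw' : w ᵥ* N.1 ≠ 0 := by
    intro h
    apply hw
    rw [← Matrix.vecMul_one w, ← Units.val_one, ← mul_inv_cancel N, Units.val_mul,
      ← Matrix.vecMul_vecMul, h, Matrix.zero_vecMul]
  let δ : ℕ → PGL(2, F 𝔭) := fun j => γ (j + k) 𝔭 * (γ k 𝔭)⁻¹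
  have hδmem : ∀ j, δ j ∈ integralAway Γ 𝔭 := fun j =>
    mem_integralAway.2 ⟨γ (j + k) * (γ k)⁻¹, mul_mem (hγ _) (inv_mem (hγ _)),
      fun q hq => hk q hq _ (Nat.le_add_left _ _), rfl⟩
  have hδ : ConvergesTo δ (Matrix.vecMulVec u (w ᵥ* N.1)) := by
    have := ((hA 𝔭).comp (tendsto_add_atTop_nat k)).mul_mk N
    rwa [hA𝔭, Matrix.vecMulVec_mul, hN] at this
  have hclos := mem_closure_cone_iff.2 ⟨δ, hδmem, hδ⟩
  let y' := Matrix.ProjGenLinGroup.map (ι 𝔭) (γ k 𝔭) • y 𝔭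
  have hlimδ : Tendsto (fun j => Matrix.ProjGenLinGroup.map (ι 𝔭) (δ j) • y') atTop
      (𝓝 (ProjLine.incl (ι 𝔭) x₀)) := by
    rw [← hx𝔭]
    refine ((hlim 𝔭).comp (tendsto_add_atTop_nat k)).congr fun j => ?_
    simp only [δ, y', smul_smul, ← map_mul, inv_mul_cancel_right, Function.comp_apply]
  -- The repelling point is itself an attractor, so its orbit stays in the closed set of attractors.
  -- Any other base point is moved to `u`.
  by_cases hy' : y' =
      ProjLine.incl (ι 𝔭) (Projectivization.mk (F 𝔭) (rot (w ᵥ* N.1)) (rot_ne_zero hw'))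
  · simp only [hy', map_smul_incl] at hlimδ
    have := (isClosedEmbedding_incl (hι 𝔭)).isInducing.tendsto_nhds_iff.2 hlimδ
    exact (isClosed_attractors _).mem_of_tendsto this (.of_forall fun j =>
      smul_mem_attractors (hδmem j) (mk_rot_mem_attractors hu hw' hclos))
  · have := tendsto_nhds_unique (hδ.tendsto_smul_of_ne (hι 𝔭) hu hw' hy') hlimδ
    exact ⟨u, _, hu, hw', hclos, incl_injective _ this⟩

lemma exists_two_ne_of_three_le_encard {X : Type*} {s : Set X} (hs : 3 ≤ s.encard) (b : X) :
    ∃ c ∈ s, ∃ d ∈ s, c ≠ d ∧ c ≠ b ∧ d ≠ b := by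
  have h1 : 1 < (s \ {b}).encard := by
    have h2 := Set.encard_le_encard_sdiff_add_encard s {b}
    rw [Set.encard_singleton] at h2
    by_contra! h3
    have h4 : s.encard ≤ 1 + 1 := h2.trans (add_le_add_left h3 1)
    have h5 := hs.trans h4
    norm_num at h5
  obtain ⟨c, d, hc, hd, hcd⟩ := Set.one_lt_encard_iff.1 h1
  exact ⟨c, hc.1, d, hd.1, hcd, hc.2, hd.2⟩

/-- The classification of the limit sets of a plectic group, for embeddings into a topological
field `C` none of which is surjective. -/
theorem IsPlecticWith.classification [T2Space C] (hL : IsPlecticWith ι Γ L)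
    (hι : ∀ q, Continuous (ι q)) (hsurj : ∀ q, ¬ Function.Surjective (ι q)) (𝔭 : S) :
    L 𝔭 = ∅ ∨ ((L 𝔭).encard = 1 ∧ ¬ CharZero (F 𝔭)) ∨ (L 𝔭).encard = 2 ∨ Perfect (L 𝔭) := by
  have hLattr : L 𝔭 = attractors (integralAway Γ 𝔭) :=
    (hL.subset_attractors hι hsurj 𝔭).antisymm (hL.attractors_subset hι hsurj 𝔭)
  by_cases h3 : 3 ≤ (L 𝔭).encard
  · right; right; right
    rw [hLattr] at h3 ⊢
    exact perfect_attractors (exists_two_ne_of_three_le_encard h3)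
  · have hlt : (L 𝔭).encard < 3 := not_le.1 h3
    obtain ⟨n, hn⟩ := ENat.ne_top_iff_exists.1 hlt.ne_top
    rw [← hn] at hlt
    have hn3 : n < 3 := by exact_mod_cast hlt
    interval_cases n
    · left
      exact Set.encard_eq_zero.1 hn.symm
    · right; left
      refine ⟨hn.symm, fun hchar => ?_⟩
      obtain ⟨x, hx⟩ := Set.encard_eq_one.1 hn.symm
      exact attractors_ne_singleton
        (fun g A hg hgA hA => hL.not_injective hι hsurj hg hgA hA) x (hLattr.symm.trans hx)
    · right; right; left
      exact hn.symm

end Main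

end Plectic

/-- `K` is a non-archimedean local field (locally compact, nontrivially valued) with a chosen
absolute value, `𝐂` is the completion of its algebraic closure, and `F_S = ∏ F_𝔭` is a finite
product of local fields of residue characteristic `p` with embeddings `ι_𝔭 : F_𝔭 → 𝐂`. -/
theorem mainTheorem9 (p : ℕ) [Fact p.Prime]
    (K : Type*) [NontriviallyNormedField K] [IsUltrametricDist K] [ProperSpace K]
    {S : Type*} [Finite S] (F : S → Type*) [∀ 𝔭, Field (F 𝔭)] [∀ 𝔭, ValuativeRel (F 𝔭)]
    [∀ 𝔭, TopologicalSpace (F 𝔭)] [∀ 𝔭, IsNonarchimedeanLocalField (F 𝔭)]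
    [∀ 𝔭, CharP 𝓀[F 𝔭] p]
    (ι : ∀ 𝔭, F 𝔭 →+* Plectic.CompletedAlgCl K) (_hι : ∀ 𝔭, Continuous (ι 𝔭))
    (Γ : Subgroup (∀ 𝔭, PGL(2, F 𝔭))) (L : ∀ 𝔭, Set (Plectic.ProjLine (F 𝔭)))
    (_hL : Plectic.IsPlecticWith ι Γ L) (𝔭 : S) :
    L 𝔭 = ∅ ∨ ((L 𝔭).encard = 1 ∧ CharP (F 𝔭) p) ∨ (L 𝔭).encard = 2 ∨ Perfect (L 𝔭) := by
  rcases _hL.classification _hι (fun q => Plectic.not_surjective_completedAlgCl (_hι q)) 𝔭 with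
    h | ⟨h1, h2⟩ | h | h
  · exact .inl h
  · exact .inr (.inl ⟨h1, (Plectic.charP_or_charZero_of_residueField p (F 𝔭)).resolve_right h2⟩)
  · exact .inr (.inr (.inl h))
  · exact .inr (.inr (.inr h))
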